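/- Let $W_{\alpha,\beta}(z)=\sum_{k\ge 0}\frac{z^k}{k!\,\Gamma(\alpha k+\beta)}$ be the Wright function, $I_0(z)=\sum_{k\ge 0}\frac{(z/2)^{2k}}{(k!)^2}$ the modified Bessel function of the first kind of order $0$, and $\gamma_0$ the Euler--Mascheroni constant. For $0<a\le 1$ let $\Phi_{a,b}(t,t')$ ($t,t'>0$) denote the kernel whose Laplace transform in $t$ is $s^{-b}e^{-t's^{a}}$, that is: * for $0<a<1$ and $b\le 1$, $$\Phi_{a,b}(t,t')=\frac1\pi\int_0^{\infty}\frac{\sin\left(t'u^a\sin(\pi a)+\pi b\right)}{u^{b}\exp\left(ut+t'u^a\cos(\pi a)\right)}\,du+\delta_{b,1},$$ where $\delta_{b,1}$ is the Kronecker symbol; * for $0<a<1$ and $b>1$ (where the last integral diverges), $\Phi_{a,b}(t,t')=\frac1{\Gamma(b-1)}\int_0^t (t-x)^{b-2}\,\Phi_{a,1}(x,t')\,dx$; * for $a=1$ and $b>0$, $\Phi_{1,b}(t,t')=(t-t')^{b-1}/\Gamma(b)$ if $t'<t$ and $0$ otherwise (so $\Phi_{1,1}(t,t')$ is the Heaviside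 function of $t-t'$); * $\Phi_{1,0}(t,t')=\delta(t-t')$, i.e. $\int_0^\infty \Phi_{1,0}(t,t')f(t')\,dt'=f(t)$. Let $0<\alpha\le 1$ and $\beta>0$ with $\alpha+\beta>1$, and $\beta\ge 1$ in case $\alpha=1$; let $\lambda\in\mathbb C$. Then, for every $t\ge 0$, the function $\alpha\mapsto t^{\beta-1}W_{\alpha,\beta}(\lambda t^{\alpha})$ is differentiable at $\alpha$ and $$\frac{\partial}{\partial\alpha}\left[t^{\beta-1}W_{\alpha,\beta}(\lambda t^{\alpha})\right]=\lambda\int_0^t\left(\ln(t-t_1)+\gamma_0\right)\left(\int_0^{\infty}\Phi_{\alpha,\beta-1}(t_1,t_2)\,I_0\left(2\sqrt{\lambda t_2}\right)dt_2\right)dt_1 ,$$ where all the integrals (those that define $\Phi_{\alpha,\beta-1}(t_1,t_2)$ for $t_1,t_2>0$, the integral over $t_2$ for every $t_1>0$, and the integral over $t_1$) converge absolutely. At $t=0$, where $t^{\beta-1}$ is infinite if $\beta<1$, both sides of the formula are read as $0$. -/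

import Mathlib

open MeasureTheory Set

noncomputable section

namespace EfrosWright

/-- The Wright function `W_{a,b}(z) = ∑ z ^ k / (k! Γ(a k + b))`. -/
def wright (a b : ℝ) (z : ℂ) : ℂ :=
  ∑' k : ℕ, z ^ k / ((k.factorial : ℂ) * (Real.Gamma (a * k + b) : ℂ))

/-- The modified Bessel function of the first kind of order zero,
`I_0(z) = ∑ (z / 2) ^ (2 k) / (k!) ^ 2`. -/
def besselI0 (z : ℂ) : ℂ :=
  ∑' k : ℕ, (z / 2) ^ (2 * k) / ((k.factorial : ℂ) ^ 2)

/-- The integrand, as a function of `u > 0`, of the integral that defines the kernel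
`Φ_{a,b}(t,t')`. -/
def phiIntegrand (a b t t' u : ℝ) : ℝ :=
  Real.sin (t' * u ^ a * Real.sin (Real.pi * a) + Real.pi * b) /
    (u ^ b * Real.exp (u * t + t' * u ^ a * Real.cos (Real.pi * a)))

/-- The integral formula for the kernel `Φ_{a,b}(t,t')`, including the Kronecker symbol
`δ_{b,1}`. For `0 < a < 1` and `t, t' > 0` the integral converges exactly when `b ≤ 1`. -/
def phiFormula (a b t t' : ℝ) : ℝ :=
  Real.pi⁻¹ * (∫ u in Ioi (0 : ℝ), phiIntegrand a b t t' u) + (if b = 1 then 1 else 0)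

/-- The kernel `Φ_{a,b}(t,t')` for `0 < a ≤ 1` and `t, t' > 0`, whose Laplace transform in `t` is
`s ^ (-b) * exp (-t' * s ^ a)`:

* for `0 < a < 1` and `b ≤ 1` it is given by the integral formula;
* for `0 < a < 1` and `b > 1`, where that integral diverges at `u = 0`, it is the
  Riemann-Liouville integral of order `b - 1`, in `t`, of `Φ_{a,1}(t,t')`, since
  `s ^ (-b) = s ^ (-(b - 1)) * s ^ (-1)`;
* for `a = 1` and `b > 0` it is `(t - t')_+ ^ (b - 1) / Γ(b)`, so that `Φ_{1,1}` is the Heaviside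
  function of `t - t'`.

The delta function `Φ_{1,0}` is treated in `phiPairing`. -/
def phi (a b t t' : ℝ) : ℝ :=
  if a = 1 then
    if t' < t then (t - t') ^ (b - 1) / Real.Gamma b else 0
  else if b ≤ 1 then
    phiFormula a b t t'
  else
    (Real.Gamma (b - 1))⁻¹ * ∫ x in (0 : ℝ)..t, (t - x) ^ (b - 2) * phiFormula a 1 x t'

open Classical in
/-- The integral `∫_0^∞ Φ_{a,b}(t,t') f(t') dt'` for `t > 0`; for `a = 1`, `b = 0` the kernel is
the delta function at `t' = t`, so that the value is `f t`. -/
def phiPairing (a b t : ℝ) (f : ℝ → ℂ) : ℂ :=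
  if a = 1 ∧ b = 0 then f t else ∫ t' in Ioi (0 : ℝ), (phi a b t t' : ℂ) * f t'

/-- The function `t' ↦ I_0(2 √(c t'))`. As `I_0` is even, the choice of the root is immaterial. -/
def besselFactor (c : ℂ) (t' : ℝ) : ℂ :=
  besselI0 (2 * (c * (t' : ℂ)) ^ (1 / 2 : ℂ))

/-- The integrals in the definition of `phi a b t t'` converge: the integral over `u` for
`b ≤ 1`; for `b > 1` the integrals over `u` in `Φ_{a,1}(x,t')` and the integral over `x`. -/
def PhiConverges (a b t t' : ℝ) : Prop :=
  (a ≠ 1 → b ≤ 1 → IntegrableOn (phiIntegrand a b t t') (Ioi 0)) ∧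
  (a ≠ 1 → 1 < b →
    (∀ x : ℝ, 0 < x → IntegrableOn (phiIntegrand a 1 x t') (Ioi 0)) ∧
    IntervalIntegrable (fun x => (t - x) ^ (b - 2) * phiFormula a 1 x t') volume 0 t)

/-- The outer integrand `(ln (t - t₁) + γ₀) ∫_0^∞ Φ_{α,β-1}(t₁,t₂) I_0(2 √(c t₂)) dt₂`, where
`γ₀` is the Euler-Mascheroni constant. -/
def outerIntegrand (α β : ℝ) (c : ℂ) (t t₁ : ℝ) : ℂ :=
  ((Real.log (t - t₁) + Real.eulerMascheroniConstant : ℝ) : ℂ) *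
    phiPairing α (β - 1) t₁ (besselFactor c)

end EfrosWright

end

open MeasureTheory Set

noncomputable section

namespace EfrosWright

open Filter Topology

/-! Put p_q(x) = x^(q-1)/Γ(q) (`rlPower`) and S_{a,q}(x) = ∑ λ^k/k! · p_{ak+q}(x) (`wrightSeries`),
so that t^(β-1) W_{a,β}(λ t^a) = S_{a,β}(t) for t > 0. Two independent facts meet in the function
S_{α,α+β-1}.

The derivative. Differentiating Euler's beta integral in one exponent at 1, with Γ'(1) = -γ₀, gives
∂/∂p p_{p+1}(t) = ∫_0^t (ln(t-x) + γ₀) p_p(x) dx (`hasDerivAt_rlPower`). In S_{a,β} the chain rule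
produces a factor k, which kills the term k = 0 and shifts the index; hence the derivative is λ
times the integral of the logarithmic kernel against S_{α,α+β-1}
(`hasDerivAt_wrightSeries_integral`). The interchanges with the sum hold because 1/Γ is bounded on
the positive half-line, which leaves exponential series as majorants.

The inner integral. It equals S_{α,α+β-1}(t₁) (`phiPairing_besselFactor`). Since I_0(2√(λy)) = ∑ λ^k
y^k/(k!)^2, it is enough that Φ_{a,b}(t,·) decays exponentially and that its k-th moment is k!
p_{ak+a+b}(t). The real integral for Φ shows neither, because cos(πa) may be negative. It is the
imaginary part of an integral of e^(ts) s^(-b) e^(-y s^a) along the upper edge of the negative axis,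
and this edge is deformed to a ray from 1 of angle θ with π/2 < θ < π and aθ < π/2. There e^(ts)
decays and Re s^a is bounded below by a positive constant; Fubini and Hankel's integral for 1/Γ then
give the moments (`integral_wedgeKernel_mul_pow`). For b = 1 the pole at the origin is subtracted
first, which accounts for the Kronecker symbol. The case b > 1 is a Riemann-Liouville integral of
the case b = 1, and for a = 1 the kernel is explicit. -/

/-- The Riemann-Liouville power `x ^ (p - 1) / Γ(p)`, whose Laplace transform is `s ^ (-p)`. -/
def rlPower (p x : ℝ) : ℝ := x ^ (p - 1) / Real.Gamma p

/-- The series `∑ lam ^ k / k! * x ^ (a k + q - 1) / Γ(a k + q)`. -/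
def wrightSeries (a q : ℝ) (lam : ℂ) (x : ℝ) : ℂ :=
  ∑' k : ℕ, lam ^ k / (k.factorial : ℂ) * (rlPower (a * k + q) x : ℂ)

/-! ### Bounds for 1/Γ and beta integrals -/

theorem exp_neg_two_div_two_le_Gamma {x : ℝ} (hx : 0 < x) : Real.exp (-2) / 2 ≤ Real.Gamma x := by
  rw [Real.Gamma_eq_integral hx]
  have hint := Real.GammaIntegral_convergent hx
  -- Only the part of the Γ integral over (1, 2] is kept: there e^(-y) ≥ e^(-2), and y^(x-1) ≥
  -- y^(-1) ≥ 1/2 because x > 0.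
  calc Real.exp (-2) / 2 = ∫ _ in Ioc (1 : ℝ) 2, Real.exp (-2) / 2 := by norm_num
    _ ≤ ∫ y in Ioc (1 : ℝ) 2, Real.exp (-y) * y ^ (x - 1) := by
        refine setIntegral_mono_on (by simp) (hint.mono_set fun y hy => ?_) measurableSet_Ioc
          fun y hy => ?_
        · exact lt_trans one_pos hy.1
        · have h1 : (1 / 2 : ℝ) ≤ y ^ (x - 1) := by
            calc (1 / 2 : ℝ) ≤ y⁻¹ := by
                  rw [one_div]; exact inv_anti₀ (by linarith [hy.1]) hy.2
              _ = y ^ (-1 : ℝ) := (Real.rpow_neg_one y).symm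
              _ ≤ y ^ (x - 1) := Real.rpow_le_rpow_of_exponent_le hy.1.le (by linarith)
          have h2 : Real.exp (-2) ≤ Real.exp (-y) := Real.exp_le_exp.2 (by linarith [hy.2])
          calc Real.exp (-2) / 2 = Real.exp (-2) * (1 / 2) := by ring
            _ ≤ _ := by gcongr
    _ ≤ _ := by
        refine setIntegral_mono_set hint ?_ (LE.le.eventuallyLE fun y hy => ?_)
        · filter_upwards [self_mem_ae_restrict measurableSet_Ioi] with y hy
          have : (0 : ℝ) < y := hy
          simp only [Pi.zero_apply]; positivity
        · exact lt_trans one_pos hy.1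

/-- An upper bound for `1 / Γ` on the positive half-line. -/
def invGammaBound : ℝ := 2 * Real.exp 2

theorem invGammaBound_pos : 0 < invGammaBound := by unfold invGammaBound; positivity

theorem inv_Gamma_le {x : ℝ} (hx : 0 < x) : (Real.Gamma x)⁻¹ ≤ invGammaBound := by
  have h := exp_neg_two_div_two_le_Gamma hx
  have : invGammaBound = (Real.exp (-2) / 2)⁻¹ := by
    rw [invGammaBound, Real.exp_neg]; field_simp
  rw [this]
  exact inv_anti₀ (by positivity) h

theorem norm_pow_div_factorial (z : ℂ) (k : ℕ) :
    ‖z ^ k / (k.factorial : ℂ)‖ = ‖z‖ ^ k / (k.factorial : ℝ) := by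
  rw [norm_div, norm_pow, Complex.norm_natCast]

/-- Each half of the interval contains only one singular endpoint, and the reflection x ↦ t - x
exchanges the roles of the exponents, so the left half suffices. -/
theorem betaKernel_intervalIntegrable {t c p : ℝ} (ht : 0 < t) (hc : 0 < c) (hp : 0 < p) :
    IntervalIntegrable (fun x => (t - x) ^ (c - 1) * x ^ (p - 1)) volume 0 t := by
  have left : ∀ {c p : ℝ}, 0 < p →
      IntervalIntegrable (fun x => (t - x) ^ (c - 1) * x ^ (p - 1)) volume 0 (t / 2) := by
    intro c p hp
    apply IntervalIntegrable.continuousOn_mul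
    · exact intervalIntegral.intervalIntegrable_rpow' (by linarith)
    · intro x hx
      rw [uIcc_of_le (by positivity)] at hx
      apply ContinuousAt.continuousWithinAt
      exact ContinuousAt.rpow_const (by fun_prop) (Or.inl (by linarith [hx.2]))
  refine (left hp).trans ?_
  have h := (left (c := p) (p := c) hc).comp_sub_left t
  have h2 := h.symm
  rw [sub_zero, show t - t / 2 = t / 2 by ring] at h2
  refine h2.congr fun x _ => ?_
  simp only [sub_sub_cancel]
  ring

theorem integral_betaKernel {t c p : ℝ} (ht : 0 < t) (hc : 0 < c) (hp : 0 < p) :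
    ∫ x in (0 : ℝ)..t, (t - x) ^ (c - 1) * x ^ (p - 1) =
      Real.Gamma c * Real.Gamma p / Real.Gamma (c + p) * t ^ (c + p - 1) := by
  have h1 := Complex.betaIntegral_scaled (p : ℂ) (c : ℂ) ht
  have h2 := Complex.Gamma_mul_Gamma_eq_betaIntegral (s := (p : ℂ)) (t := (c : ℂ))
    (by simpa using hp) (by simpa using hc)
  have h3 : Complex.betaIntegral p c =
      ((Real.Gamma c * Real.Gamma p / Real.Gamma (c + p) : ℝ) : ℂ) := by
    have h0 : (Real.Gamma (c + p) : ℂ) ≠ 0 := by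
      exact_mod_cast (Real.Gamma_pos_of_pos (by linarith)).ne'
    push_cast
    rw [eq_div_iff h0, ← Complex.Gamma_ofReal, ← Complex.Gamma_ofReal, ← Complex.Gamma_ofReal]
    push_cast
    rw [mul_comm (Complex.Gamma c), h2, add_comm (c : ℂ)]
    ring
  apply Complex.ofReal_injective
  rw [← intervalIntegral.integral_ofReal]
  calc (∫ x in (0 : ℝ)..t, (((t - x) ^ (c - 1) * x ^ (p - 1) : ℝ) : ℂ))
      = ∫ x in (0 : ℝ)..t, (x : ℂ) ^ ((p : ℂ) - 1) * ((t : ℂ) - x) ^ ((c : ℂ) - 1) := by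
        apply intervalIntegral.integral_congr
        intro x hx
        rw [uIcc_of_le ht.le] at hx
        simp only
        rw [Complex.ofReal_mul, Complex.ofReal_cpow (by linarith [hx.2]),
          Complex.ofReal_cpow hx.1]
        push_cast
        ring
    _ = _ := by
        rw [h1, h3, Complex.ofReal_mul _ (t ^ _), Complex.ofReal_cpow ht.le]
        push_cast
        rw [add_comm (p : ℂ)]
        ring

/-- The beta integral in normalized form: under convolution, the orders of Riemann-Liouville powers
add. -/
theorem integral_rlKernel_mul_rlPower {t c p : ℝ} (ht : 0 < t) (hc : 0 < c) (hp : 0 < p) :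
    ∫ x in (0 : ℝ)..t, rlPower c (t - x) * rlPower p x = rlPower (c + p) t := by
  have h1 := (Real.Gamma_pos_of_pos hc).ne'
  have h2 := (Real.Gamma_pos_of_pos hp).ne'
  calc ∫ x in (0 : ℝ)..t, rlPower c (t - x) * rlPower p x
      = ∫ x in (0 : ℝ)..t, (Real.Gamma c * Real.Gamma p)⁻¹ * ((t - x) ^ (c - 1) * x ^ (p - 1)) := by
        congr 1; ext x; rw [rlPower, rlPower]; field_simp
    _ = _ := by
        rw [intervalIntegral.integral_const_mul, integral_betaKernel ht hc hp, rlPower]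
        field_simp

/-! ### Convergence and termwise integration of the series -/

/-- The part of `wrightSeries` that is left when the power `x ^ (q - 1)` is taken out. -/
def wrightSeriesCore (a q : ℝ) (lam : ℂ) (x : ℝ) : ℂ :=
  ∑' k : ℕ, lam ^ k / (k.factorial : ℂ) * ((x ^ (a * k) / Real.Gamma (a * k + q) : ℝ) : ℂ)

/-- Boundedness of 1/Γ leaves an exponential series as majorant, uniformly on [0, t]. Summability,
continuity and dominated convergence all use it. -/
theorem norm_wrightSeriesCore_term_le {a q : ℝ} (ha : 0 ≤ a) (hq : 0 < q) (lam : ℂ) {x t : ℝ}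
    (hx : 0 ≤ x) (hxt : x ≤ t) (k : ℕ) :
    ‖lam ^ k / (k.factorial : ℂ) * ((x ^ (a * k) / Real.Gamma (a * k + q) : ℝ) : ℂ)‖ ≤
      invGammaBound * ((‖lam‖ * t ^ a) ^ k / k.factorial) := by
  have hk : 0 < a * k + q := by positivity
  rw [norm_mul, norm_pow_div_factorial, Complex.norm_real, Real.norm_of_nonneg
    (div_nonneg (by positivity) (Real.Gamma_pos_of_pos hk).le), div_eq_mul_inv (x ^ (a * k))]
  have h1 : x ^ (a * k) ≤ (t ^ a) ^ k := by
    rw [← Real.rpow_natCast, ← Real.rpow_mul (hx.trans hxt)]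
    exact Real.rpow_le_rpow hx hxt (by positivity)
  have h3 : 0 ≤ t ^ a := Real.rpow_nonneg (hx.trans hxt) _
  have h4 := inv_nonneg.2 (Real.Gamma_pos_of_pos hk).le
  calc ‖lam‖ ^ k / k.factorial * (x ^ (a * k) * (Real.Gamma (a * k + q))⁻¹)
      ≤ ‖lam‖ ^ k / k.factorial * ((t ^ a) ^ k * invGammaBound) := by
        gcongr
        exact inv_Gamma_le hk
    _ = _ := by rw [mul_pow]; ring

theorem summable_wrightSeriesCore {a q : ℝ} (ha : 0 ≤ a) (hq : 0 < q) (lam : ℂ) {x : ℝ}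
    (hx : 0 ≤ x) : Summable fun k : ℕ =>
      lam ^ k / (k.factorial : ℂ) * ((x ^ (a * k) / Real.Gamma (a * k + q) : ℝ) : ℂ) :=
  Summable.of_norm_bounded (g := fun k : ℕ => invGammaBound * ((‖lam‖ * x ^ a) ^ k / k.factorial))
    ((Real.summable_pow_div_factorial (‖lam‖ * x ^ a)).mul_left invGammaBound)
    (norm_wrightSeriesCore_term_le ha hq lam hx le_rfl)

theorem continuousOn_wrightSeriesCore {a q : ℝ} (ha : 0 ≤ a) (hq : 0 < q) (lam : ℂ) (t : ℝ) :
    ContinuousOn (wrightSeriesCore a q lam) (Icc 0 t) := by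
  have hsum := (Real.summable_pow_div_factorial (‖lam‖ * t ^ a)).mul_left invGammaBound
  refine continuousOn_tsum (fun k => ?_) hsum
    (fun k x hx => norm_wrightSeriesCore_term_le ha hq lam hx.1 hx.2 k)
  apply Continuous.continuousOn
  have : Continuous fun x : ℝ => x ^ (a * k) :=
    continuous_id.rpow_const fun x => Or.inr (by positivity)
  fun_prop

theorem rlPower_eq_mul {a q x : ℝ} (hx : 0 < x) (k : ℕ) :
    rlPower (a * k + q) x = x ^ (q - 1) * (x ^ (a * k) / Real.Gamma (a * k + q)) := by
  rw [rlPower, show a * k + q - 1 = (q - 1) + a * k by ring, Real.rpow_add hx]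
  ring

theorem wrightSeries_eq_mul {a q : ℝ} (lam : ℂ) {x : ℝ} (hx : 0 < x) :
    wrightSeries a q lam x = ((x ^ (q - 1) : ℝ) : ℂ) * wrightSeriesCore a q lam x := by
  rw [wrightSeries, wrightSeriesCore, ← tsum_mul_left]
  congr 1; ext k
  rw [rlPower_eq_mul hx]
  push_cast
  ring

theorem hasSum_wrightSeries {a q : ℝ} (ha : 0 ≤ a) (hq : 0 < q) (lam : ℂ) {x : ℝ} (hx : 0 < x) :
    HasSum (fun k : ℕ => lam ^ k / (k.factorial : ℂ) * (rlPower (a * k + q) x : ℂ))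
      (wrightSeries a q lam x) := by
  rw [wrightSeries_eq_mul lam hx]
  convert! ((summable_wrightSeriesCore ha hq lam hx.le).hasSum.mul_left
    ((x ^ (q - 1) : ℝ) : ℂ)) using 1
  ext k
  rw [rlPower_eq_mul hx]
  push_cast
  ring

theorem intervalIntegrable_mul_wrightSeries {a q t : ℝ} (ha : 0 ≤ a) (hq : 0 < q) (ht : 0 ≤ t)
    (lam : ℂ) {w : ℝ → ℝ} (hw : IntervalIntegrable (fun x => w x * x ^ (q - 1)) volume 0 t) :
    IntervalIntegrable (fun x => (w x : ℂ) * wrightSeries a q lam x) volume 0 t := by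
  have h1 : IntervalIntegrable (fun x => ((w x * x ^ (q - 1) : ℝ) : ℂ)) volume 0 t := ⟨hw.1.ofReal, hw.2.ofReal⟩
  have h2 := h1.mul_continuousOn (g := wrightSeriesCore a q lam)
    (by rw [uIcc_of_le ht]; exact continuousOn_wrightSeriesCore ha hq lam t)
  refine h2.congr_ae ?_
  rw [uIoc_of_le ht]
  filter_upwards [self_mem_ae_restrict measurableSet_Ioc] with x hx
  rw [wrightSeries_eq_mul lam hx.1]
  push_cast
  ring

/-- Dominated convergence, with the singular power x^(q-1) assigned to the weight. The weight is
left general to cover both the Riemann-Liouville kernel and the logarithmic one. -/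
theorem hasSum_integral_mul_wrightSeries {a q t : ℝ} (ha : 0 ≤ a) (hq : 0 < q) (ht : 0 ≤ t)
    (lam : ℂ) {w : ℝ → ℝ} (hw : IntervalIntegrable (fun x => w x * x ^ (q - 1)) volume 0 t) :
    HasSum (fun k : ℕ => lam ^ k / (k.factorial : ℂ) *
        ((∫ x in (0 : ℝ)..t, w x * rlPower (a * k + q) x : ℝ) : ℂ))
      (∫ x in (0 : ℝ)..t, (w x : ℂ) * wrightSeries a q lam x) := by
  have hpow : ∀ k : ℕ, Continuous fun x : ℝ => x ^ (a * k) :=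
    fun k => continuous_id.rpow_const fun x => Or.inr (by positivity)
  have key := intervalIntegral.hasSum_integral_of_dominated_convergence (μ := volume)
    (a := 0) (b := t) (ι := ℕ)
    (F := fun k x => (w x : ℂ) * (lam ^ k / (k.factorial : ℂ) * (rlPower (a * k + q) x : ℂ)))
    (f := fun x => (w x : ℂ) * wrightSeries a q lam x)
    (fun k x => ‖w x * x ^ (q - 1)‖ * (invGammaBound * ((‖lam‖ * t ^ a) ^ k / k.factorial)))
    (fun k => ?_) (fun k => ?_) ?_ ?_ ?_
  · convert! key using 1
    ext k
    rw [← intervalIntegral.integral_ofReal, ← intervalIntegral.integral_const_mul]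
    congr 1; ext x
    push_cast
    ring
  · have h1 : IntervalIntegrable (fun x => ((w x * x ^ (q - 1) : ℝ) : ℂ)) volume 0 t := ⟨hw.1.ofReal, hw.2.ofReal⟩
    have h2 := h1.mul_continuousOn (g := fun x => lam ^ k / (k.factorial : ℂ) *
      ((x ^ (a * k) / Real.Gamma (a * k + q) : ℝ) : ℂ)) (by
        apply Continuous.continuousOn
        have := hpow k
        fun_prop)
    have h3 := (intervalIntegrable_iff.1 h2).aestronglyMeasurable
    refine h3.congr ?_
    rw [uIoc_of_le ht]
    filter_upwards [self_mem_ae_restrict measurableSet_Ioc] with x hx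
    rw [rlPower_eq_mul hx.1]
    push_cast
    ring
  · refine Eventually.of_forall fun x hx => ?_
    rw [uIoc_of_le ht] at hx
    have h := norm_wrightSeriesCore_term_le ha hq lam hx.1.le hx.2 k
    rw [rlPower_eq_mul hx.1]
    calc _ = ‖w x * x ^ (q - 1)‖ * ‖lam ^ k / (k.factorial : ℂ) *
          ((x ^ (a * k) / Real.Gamma (a * k + q) : ℝ) : ℂ)‖ := by
          rw [← Complex.norm_real (w x * _), ← norm_mul]
          congr 1
          push_cast
          ring
      _ ≤ _ := by gcongr
  · refine Eventually.of_forall fun x hx => ?_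
    exact ((Real.summable_pow_div_factorial _).mul_left _).mul_left _
  · simp_rw [tsum_mul_left]
    exact hw.norm.mul_const _
  · refine Eventually.of_forall fun x hx => ?_
    rw [uIoc_of_le ht] at hx
    exact (hasSum_wrightSeries ha hq lam hx.1).mul_left _

theorem rlKernel_intervalIntegrable {t c p : ℝ} (ht : 0 < t) (hc : 0 < c) (hp : 0 < p) :
    IntervalIntegrable (fun x => rlPower c (t - x) * x ^ (p - 1)) volume 0 t := by
  refine ((betaKernel_intervalIntegrable ht hc hp).const_mul (Real.Gamma c)⁻¹).congr fun x _ => ?_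
  simp only [rlPower]
  ring

/-- The Riemann-Liouville integral of order `c` of the series. -/
theorem integral_rlKernel_mul_wrightSeries {a q c t : ℝ} (ha : 0 ≤ a) (hq : 0 < q) (hc : 0 < c)
    (ht : 0 < t) (lam : ℂ) :
    ∫ x in (0 : ℝ)..t, (rlPower c (t - x) : ℂ) * wrightSeries a q lam x =
      wrightSeries a (c + q) lam t := by
  refine (hasSum_integral_mul_wrightSeries ha hq ht.le lam
    (rlKernel_intervalIntegrable ht hc hq)).unique ?_
  convert! hasSum_wrightSeries ha (by positivity : 0 < c + q) lam ht using 1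
  ext k
  rw [integral_rlKernel_mul_rlPower ht hc (by positivity)]
  ring_nf

/-! ### Derivative of the Riemann-Liouville power in its order -/

/-- The kernel `ln y + γ₀`. -/
def logKernel (y : ℝ) : ℝ := Real.log y + Real.eulerMascheroniConstant

/-- The integral `∫_0^t (ln (t - x) + γ₀) x ^ (p - 1) / Γ(p) dx`. -/
def rlPowerDeriv (t p : ℝ) : ℝ := ∫ x in (0 : ℝ)..t, logKernel (t - x) * rlPower p x

/-- Both |log y| / 4 and y^(c-1) are at most y^(1/4) + y^(-1/4), and the square of this sum has
three terms. Their exponents are written as 3/2 - 1, 1 - 1 and 1/2 - 1 so that the bound is a sum of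
integrable beta kernels. -/
theorem abs_log_mul_rpow_le {y c : ℝ} (hy : 0 < y) (hc : |c - 1| ≤ 1 / 4) :
    |Real.log y * y ^ (c - 1)| ≤
      4 * (y ^ ((3 / 2 : ℝ) - 1) + 2 * y ^ ((1 : ℝ) - 1) + y ^ ((1 / 2 : ℝ) - 1)) := by
  have hP := Real.rpow_pos_of_pos hy (1 / 4)
  have hN := Real.rpow_pos_of_pos hy (-(1 / 4))
  have hlog : |Real.log y| ≤ 4 * (y ^ (1 / 4 : ℝ) + y ^ (-(1 / 4) : ℝ)) := by
    have h1 := Real.log_le_rpow_div hy.le (by norm_num : (0 : ℝ) < 1 / 4)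
    have h2 := Real.log_le_rpow_div (inv_pos.2 hy).le (by norm_num : (0 : ℝ) < 1 / 4)
    rw [Real.log_inv, Real.inv_rpow hy.le, ← Real.rpow_neg hy.le] at h2
    rw [abs_le]
    constructor <;> linarith
  have hpow : y ^ (c - 1) ≤ y ^ (1 / 4 : ℝ) + y ^ (-(1 / 4) : ℝ) := by
    rw [abs_le] at hc
    rcases le_total y 1 with h | h
    · have := Real.rpow_le_rpow_of_exponent_ge hy h (by linarith : -(1 / 4) ≤ c - 1)
      linarith
    · have := Real.rpow_le_rpow_of_exponent_le h (by linarith : c - 1 ≤ 1 / 4)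
      linarith
  have e1 : y ^ ((3 / 2 : ℝ) - 1) = y ^ (1 / 4 : ℝ) * y ^ (1 / 4 : ℝ) := by
    rw [← Real.rpow_add hy]; norm_num
  have e2 : y ^ ((1 : ℝ) - 1) = y ^ (1 / 4 : ℝ) * y ^ (-(1 / 4) : ℝ) := by
    rw [← Real.rpow_add hy]; norm_num
  have e3 : y ^ ((1 / 2 : ℝ) - 1) = y ^ (-(1 / 4) : ℝ) * y ^ (-(1 / 4) : ℝ) := by
    rw [← Real.rpow_add hy]; norm_num
  rw [abs_mul, abs_of_pos (Real.rpow_pos_of_pos hy _), e1, e2, e3]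
  calc _ ≤ (4 * (y ^ (1 / 4 : ℝ) + y ^ (-(1 / 4) : ℝ))) *
        (y ^ (1 / 4 : ℝ) + y ^ (-(1 / 4) : ℝ)) := by gcongr
    _ = _ := by ring

theorem hasDerivAt_integral_betaKernel {t p : ℝ} (ht : 0 < t) (hp : 0 < p) :
    IntervalIntegrable (fun x => Real.log (t - x) * x ^ (p - 1)) volume 0 t ∧
    HasDerivAt (fun c : ℝ => ∫ x in (0 : ℝ)..t, (t - x) ^ (c - 1) * x ^ (p - 1))
      (∫ x in (0 : ℝ)..t, Real.log (t - x) * x ^ (p - 1)) 1 := by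
  have hmeas : ∀ c : ℝ, AEStronglyMeasurable (fun x : ℝ => (t - x) ^ (c - 1) * x ^ (p - 1))
      (volume.restrict (uIoc 0 t)) := fun c => by
    apply Measurable.aestronglyMeasurable
    fun_prop
  -- At x = t the base t - x vanishes and the power is not differentiated by the usual formula; this
  -- null set is discarded.
  have hne : ∀ᵐ x : ℝ, x ≠ t := by simp [ae_iff]
  have h := intervalIntegral.hasDerivAt_integral_of_dominated_loc_of_deriv_le (μ := volume)
    (a := 0) (b := t) (F := fun c x => (t - x) ^ (c - 1) * x ^ (p - 1))
    (F' := fun c x => Real.log (t - x) * (t - x) ^ (c - 1) * x ^ (p - 1)) (x₀ := (1 : ℝ))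
    (s := Metric.closedBall 1 (1 / 4))
    (bound := fun x => 4 * ((t - x) ^ ((3 / 2 : ℝ) - 1) * x ^ (p - 1) +
      2 * ((t - x) ^ ((1 : ℝ) - 1) * x ^ (p - 1)) + (t - x) ^ ((1 / 2 : ℝ) - 1) * x ^ (p - 1)))
    (Metric.closedBall_mem_nhds _ (by norm_num)) (Eventually.of_forall hmeas)
    (betaKernel_intervalIntegrable ht one_pos hp)
    (by apply Measurable.aestronglyMeasurable; fun_prop)
    (by
      filter_upwards [hne] with x hxt hx c hc
      rw [uIoc_of_le ht.le] at hx
      have hx' : 0 < t - x := sub_pos.2 (lt_of_le_of_ne hx.2 hxt)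
      rw [Metric.mem_closedBall, Real.dist_eq] at hc
      have hxp := Real.rpow_pos_of_pos hx.1 (p - 1)
      rw [Real.norm_eq_abs, abs_mul, abs_of_pos hxp]
      calc _ ≤ _ := mul_le_mul_of_nonneg_right (abs_log_mul_rpow_le hx' hc) hxp.le
        _ = _ := by ring)
    (((betaKernel_intervalIntegrable ht (by norm_num) hp).add
      ((betaKernel_intervalIntegrable ht one_pos hp).const_mul 2)).add
      (betaKernel_intervalIntegrable ht (by norm_num) hp) |>.const_mul 4)
    (by
      filter_upwards [hne] with x hxt hx c hc
      rw [uIoc_of_le ht.le] at hx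
      have hx' : 0 < t - x := sub_pos.2 (lt_of_le_of_ne hx.2 hxt)
      have h1 := (((hasDerivAt_id c).sub_const 1).const_rpow hx').mul_const (x ^ (p - 1))
      convert! h1 using 1
      simp)
  simpa using h

theorem logKernel_intervalIntegrable {t p : ℝ} (ht : 0 < t) (hp : 0 < p) :
    IntervalIntegrable (fun x => logKernel (t - x) * x ^ (p - 1)) volume 0 t := by
  have h1 := (hasDerivAt_integral_betaKernel ht hp).1
  have h2 : IntervalIntegrable (fun x : ℝ => x ^ (p - 1)) volume 0 t :=
    intervalIntegral.intervalIntegrable_rpow' (by linarith)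
  refine (h1.add (h2.const_mul Real.eulerMascheroniConstant)).congr fun x _ => ?_
  simp only [logKernel]
  ring

/-- The beta integral equals Γ(c) Γ(p) p_{c+p}(t). Its derivative in c at c = 1 is the integral with
log(t - x) on one side, and on the other side Γ'(1) = -γ₀ times the integral of x^(p-1), plus Γ(p)
times the wanted derivative. Moving the γ₀ term across completes the kernel ln + γ₀. -/
theorem hasDerivAt_rlPower {t p : ℝ} (ht : 0 < t) (hp : 0 < p) :
    HasDerivAt (fun p => rlPower (p + 1) t) (rlPowerDeriv t p) p := by
  have hG := Real.Gamma_pos_of_pos hp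
  have hG1 := Real.Gamma_pos_of_pos (by linarith : 0 < p + 1)
  have hdiff : DifferentiableAt ℝ (fun p => rlPower (p + 1) t) p := by
    unfold rlPower
    have h1 : DifferentiableAt ℝ (fun p : ℝ => Real.Gamma (p + 1)) p :=
      (Real.differentiableAt_Gamma (fun m => by
        have : (0 : ℝ) ≤ m := by positivity
        intro h; linarith)).comp (f := fun p : ℝ => p + 1) p (by fun_prop)
    have h2 : DifferentiableAt ℝ (fun p : ℝ => t ^ (p + 1 - 1)) p :=
      (((hasDerivAt_id p).add_const 1).sub_const 1).const_rpow ht |>.differentiableAt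
    exact h2.div h1 hG1.ne'
  obtain ⟨hint, hder⟩ := hasDerivAt_integral_betaKernel ht hp
  have h2 : HasDerivAt (fun c => Real.Gamma c * Real.Gamma p * rlPower ((c + p - 1) + 1) t)
      (-Real.eulerMascheroniConstant * Real.Gamma p * rlPower (p + 1) t +
        Real.Gamma p * deriv (fun p => rlPower (p + 1) t) p) 1 := by
    have h3 : HasDerivAt (fun c : ℝ => rlPower ((c + p - 1) + 1) t)
        (deriv (fun p => rlPower (p + 1) t) p) 1 := by
      have h4 : HasDerivAt (fun p => rlPower (p + 1) t) (deriv (fun p => rlPower (p + 1) t) p)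
          ((1 : ℝ) + p - 1) := by
        rw [add_sub_cancel_left]; exact hdiff.hasDerivAt
      have h5 : HasDerivAt (fun c : ℝ => c + p - 1) 1 1 :=
        ((hasDerivAt_id (1 : ℝ)).add_const p).sub_const 1
      simpa [Function.comp_def] using HasDerivAt.comp (h := fun c : ℝ => c + p - 1) (1 : ℝ) h4 h5
    convert! ((Real.hasDerivAt_Gamma_one.mul_const (Real.Gamma p)).mul h3) using 1
    simp
  have h3 := hder.unique (h2.congr_of_eventuallyEq (by
    filter_upwards [lt_mem_nhds (one_pos : (0 : ℝ) < 1)] with c hc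
    rw [integral_betaKernel ht hc hp, rlPower]
    simp only [sub_add_cancel]
    ring))
  have h4 : ∫ x in (0 : ℝ)..t, x ^ (p - 1) = Real.Gamma p * rlPower (p + 1) t := by
    have := integral_betaKernel ht one_pos hp
    simp only [sub_self, Real.rpow_zero, one_mul, Real.Gamma_one] at this
    rw [this, rlPower, add_comm 1 p]
    ring
  have h5 : rlPowerDeriv t p = deriv (fun p => rlPower (p + 1) t) p := by
    have h6 : rlPowerDeriv t p = (Real.Gamma p)⁻¹ * ((∫ x in (0 : ℝ)..t,
        Real.log (t - x) * x ^ (p - 1)) +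
        Real.eulerMascheroniConstant * ∫ x in (0 : ℝ)..t, x ^ (p - 1)) := by
      rw [← intervalIntegral.integral_const_mul, ← intervalIntegral.integral_add hint
        ((intervalIntegral.intervalIntegrable_rpow' (by linarith)).const_mul _),
        ← intervalIntegral.integral_const_mul, rlPowerDeriv]
      congr 1; ext x
      rw [logKernel, rlPower]
      ring
    rw [h6, h3, h4]
    field_simp
    ring
  rw [h5]
  exact hdiff.hasDerivAt

/-- From x^(p-1) = x^(p-p₀) x^(p₀-1), a single integral that depends only on p₀ controls all orders
p ≥ p₀, with merely geometric growth in p. -/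
theorem abs_rlPowerDeriv_le {t p₀ p : ℝ} (ht : 0 < t) (hp₀ : 0 < p₀) (hp : p₀ ≤ p) :
    |rlPowerDeriv t p| ≤ invGammaBound * t ^ (p - p₀) *
      ∫ x in (0 : ℝ)..t, |logKernel (t - x) * x ^ (p₀ - 1)| := by
  rw [← intervalIntegral.integral_const_mul, ← Real.norm_eq_abs]
  refine intervalIntegral.norm_integral_le_of_norm_le ht.le ?_
    ((logKernel_intervalIntegrable ht hp₀).abs.const_mul _)
  refine Eventually.of_forall fun x hx => ?_
  have hx0 := hx.1
  have hG := Real.Gamma_pos_of_pos (hp₀.trans_le hp)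
  rw [rlPower, Real.norm_eq_abs, show p - 1 = (p - p₀) + (p₀ - 1) by ring, Real.rpow_add hx.1,
    abs_mul, abs_div, abs_mul, abs_mul, abs_of_pos hG, abs_of_pos (Real.rpow_pos_of_pos hx.1 _),
    abs_of_pos (Real.rpow_pos_of_pos hx.1 _), div_eq_mul_inv]
  have h1 : x ^ (p - p₀) ≤ t ^ (p - p₀) := Real.rpow_le_rpow hx.1.le hx.2 (by linarith)
  have h2 := inv_Gamma_le (hp₀.trans_le hp)
  have h3 : (0 : ℝ) < x ^ (p - p₀) := Real.rpow_pos_of_pos hx.1 _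
  have h4 : (0 : ℝ) < x ^ (p₀ - 1) := Real.rpow_pos_of_pos hx.1 _
  have h5 := invGammaBound_pos
  calc |logKernel (t - x)| * (x ^ (p - p₀) * x ^ (p₀ - 1) * (Real.Gamma p)⁻¹)
      ≤ |logKernel (t - x)| * (t ^ (p - p₀) * x ^ (p₀ - 1) * invGammaBound) := by gcongr
    _ = _ := by ring

/-! ### Differentiation of the series in its first parameter -/

theorem rpow_mul_wright {a β t : ℝ} (lam : ℂ) (ht : 0 < t) :
    ((t ^ (β - 1) : ℝ) : ℂ) * wright a β (lam * ((t ^ a : ℝ) : ℂ)) = wrightSeries a β lam t := by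
  rw [wrightSeries_eq_mul lam ht, wright, wrightSeriesCore]
  congr 2; ext k
  rw [Real.rpow_mul ht.le, Real.rpow_natCast, mul_pow]
  push_cast
  ring

theorem hasDerivAt_wrightSeries {α β t : ℝ} (hα : 0 < α) (hβ : 0 < β) (hαβ : 1 < α + β)
    (ht : 0 < t) (lam : ℂ) :
    HasDerivAt (fun a => wrightSeries a β lam t)
      (∑' k : ℕ, lam ^ k / (k.factorial : ℂ) * ((k * rlPowerDeriv t (α * k + (β - 1)) : ℝ) : ℂ))
      α := by
  -- The midpoint of max(0, 1 - β) and α, which is below α because α + β > 1. For a > a₀ all orders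
  -- ak + β - 1 with k ≥ 1 stay above the positive number a₀ + β - 1.
  obtain ⟨a₀, h0, h1, h2⟩ : ∃ a₀, 0 < a₀ ∧ 0 < a₀ + (β - 1) ∧ a₀ < α := by
    refine ⟨(α + max 0 (1 - β)) / 2, ?_, ?_, ?_⟩ <;> rcases max_cases 0 (1 - β) with h | h <;>
      linarith [h.1, h.2]
  set K := ∫ x in (0 : ℝ)..t, |logKernel (t - x) * x ^ (a₀ + (β - 1) - 1)| with hK
  have hK0 : 0 ≤ K := intervalIntegral.integral_nonneg ht.le fun x _ => abs_nonneg _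
  set T := max 1 t with hT
  have hT1 : 1 ≤ T := le_max_left _ _
  -- The factor 2 absorbs k ≤ 2^k, and T ≥ 1 makes T^((α+1)k) a bound for the power of t for every a
  -- < α + 1.
  have hsum := (Real.summable_pow_div_factorial (2 * ‖lam‖ * T ^ (α + 1))).mul_left
    (invGammaBound * K)
  have hpos : ∀ a ∈ Ioo a₀ (α + 1), ∀ k : ℕ, k ≠ 0 → a₀ + (β - 1) ≤ a * k + (β - 1) := by
    intro a ha k hk
    have : (1 : ℝ) ≤ k := by exact_mod_cast Nat.one_le_iff_ne_zero.2 hk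
    nlinarith [ha.1]
  refine hasDerivAt_tsum_of_isPreconnected
    (g := fun (k : ℕ) a => lam ^ k / (k.factorial : ℂ) * (rlPower (a * k + β) t : ℂ))
    (g' := fun (k : ℕ) a =>
      lam ^ k / (k.factorial : ℂ) * ((k * rlPowerDeriv t (a * k + (β - 1)) : ℝ) : ℂ))
    hsum (isOpen_Ioo (a := a₀) (b := α + 1)) isPreconnected_Ioo (fun k a ha => ?_)
    (fun k a ha => ?_) (y₀ := α) ⟨h2, by linarith⟩ (hasSum_wrightSeries hα.le hβ lam ht).summable
    ⟨h2, by linarith⟩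
  · apply HasDerivAt.const_mul
    apply HasDerivAt.ofReal_comp
    -- The term k = 0 does not depend on a, so it does not matter that its order β - 1 may fail to
    -- be positive.
    rcases eq_or_ne k 0 with rfl | hk
    · simpa using hasDerivAt_const a _
    · have h3 := hasDerivAt_rlPower ht (h1.trans_le (hpos a ha k hk))
      have h4 := h3.comp a (((hasDerivAt_id a).mul_const (k : ℝ)).add_const (β - 1))
      convert! h4 using 1
      · ext a; simp only [Function.comp, id]; ring_nf
      · simp [mul_comm]
  · rcases eq_or_ne k 0 with rfl | hk
    · have := invGammaBound_pos
      simp only [CharP.cast_eq_zero, zero_mul, Complex.ofReal_zero, mul_zero, norm_zero]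
      positivity
    · rw [norm_mul, norm_pow_div_factorial, Complex.norm_real, Real.norm_eq_abs, abs_mul,
        abs_of_nonneg (by positivity : (0 : ℝ) ≤ k)]
      have h3 := abs_rlPowerDeriv_le ht h1 (hpos a ha k hk)
      have hk1 : (1 : ℝ) ≤ k := by exact_mod_cast Nat.one_le_iff_ne_zero.2 hk
      have h4 : t ^ (a * k + (β - 1) - (a₀ + (β - 1))) ≤ (T ^ (α + 1)) ^ k := by
        rw [← Real.rpow_natCast, ← Real.rpow_mul (by positivity)]
        calc _ ≤ T ^ (a * k + (β - 1) - (a₀ + (β - 1))) :=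
              Real.rpow_le_rpow ht.le (le_max_right _ _) (by nlinarith [ha.1])
          _ ≤ _ := Real.rpow_le_rpow_of_exponent_le hT1 (by nlinarith [ha.2])
      have h5 : (k : ℝ) ≤ 2 ^ k := by exact_mod_cast (Nat.lt_two_pow_self (n := k)).le
      have h6 := invGammaBound_pos
      calc ‖lam‖ ^ k / k.factorial * (k * |rlPowerDeriv t (a * k + (β - 1))|)
          ≤ ‖lam‖ ^ k / k.factorial * (2 ^ k * (invGammaBound * (T ^ (α + 1)) ^ k * K)) := by
            gcongr
            exact h3.trans (by gcongr)
        _ = _ := by rw [mul_pow, mul_pow]; ring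

/-- The derivative of `wrightSeries` in its first parameter, as an integral. -/
theorem hasDerivAt_wrightSeries_integral {α β t : ℝ} (hα : 0 < α) (hβ : 0 < β) (hαβ : 1 < α + β)
    (ht : 0 < t) (lam : ℂ) :
    HasDerivAt (fun a => wrightSeries a β lam t)
      (lam * ∫ x in (0 : ℝ)..t,
        (logKernel (t - x) : ℂ) * wrightSeries α (α + (β - 1)) lam x) α := by
  have hq : 0 < α + (β - 1) := by linarith
  have h1 := hasSum_integral_mul_wrightSeries hα.le hq ht.le lam
    (logKernel_intervalIntegrable ht hq)
  have h2 : HasSum (fun k : ℕ =>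
      lam ^ k / (k.factorial : ℂ) * ((k * rlPowerDeriv t (α * k + (β - 1)) : ℝ) : ℂ))
      (lam * ∫ x in (0 : ℝ)..t,
        (logKernel (t - x) : ℂ) * wrightSeries α (α + (β - 1)) lam x) := by
    -- The zeroth term vanishes. After the shift, (k+1)/(k+1)! = 1/k!, one factor λ comes out, and
    -- the order becomes αk + (α + β - 1).
    rw [← hasSum_nat_add_iff' 1]
    simp only [Finset.range_one, Finset.sum_singleton, CharP.cast_eq_zero, zero_mul,
      Complex.ofReal_zero, mul_zero, sub_zero]
    convert! h1.mul_left lam using 1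
    ext k
    rw [Nat.factorial_succ, rlPowerDeriv,
      show α * ((k + 1 : ℕ) : ℝ) + (β - 1) = α * k + (α + (β - 1)) by push_cast; ring]
    have h3 : (k : ℂ) + 1 ≠ 0 := by exact_mod_cast k.succ_ne_zero
    have h4 : (k.factorial : ℂ) ≠ 0 := by exact_mod_cast k.factorial_ne_zero
    push_cast
    field_simp
    ring
  rw [← h2.tsum_eq]
  exact hasDerivAt_wrightSeries hα hβ hαβ ht lam

/-! ### Contour deformation between rays -/

theorem integrableOn_rpow_mul_exp_neg {p d : ℝ} (hp : -1 < p) (hd : 0 < d) :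
    IntegrableOn (fun r : ℝ => r ^ p * Real.exp (-(d * r))) (Ioi 0) := by
  simpa using integrableOn_rpow_mul_exp_neg_mul_rpow hp one_pos hd

/-- If `F_x` and `G_r` have the common mixed derivative `K`, then the change of `∫ F dr` is given
by the boundary values of `G`. -/
theorem integral_Ioi_sub_eq_neg_of_mixed_deriv {a b : ℝ} (hab : a ≤ b) {F G K : ℝ → ℝ → ℂ}
    (hK : Integrable (Function.uncurry K)
      ((volume.restrict (Ioc a b)).prod (volume.restrict (Ioi 0))))
    (hF : ∀ r, 0 < r → ContinuousOn (fun x => F x r) (Icc a b))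
    (hF' : ∀ r, 0 < r → ∀ x ∈ Ioo a b, HasDerivAt (fun x => F x r) (K x r) x)
    (hG : ∀ x ∈ Ioo a b, ContinuousWithinAt (G x) (Ici 0) 0)
    (hG' : ∀ x ∈ Ioo a b, ∀ r, 0 < r → HasDerivAt (G x) (K x r) r)
    (hGt : ∀ x ∈ Ioo a b, Tendsto (G x) atTop (𝓝 0)) :
    ∫ r in Ioi (0 : ℝ), (F b r - F a r) = -∫ x in a..b, G x 0 := by
  -- Fubini takes the place of Cauchy's theorem: integrating K first in r gives the boundary values
  -- of G, and first in x the increments of F.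
  have h1 := integral_integral_swap hK
  have h2 : ∫ x in Ioc a b, ∫ r in Ioi (0 : ℝ), K x r = -∫ x in a..b, G x 0 := by
    rw [← intervalIntegral.integral_neg, intervalIntegral.integral_of_le hab]
    apply integral_congr_ae
    have hne : ∀ᵐ x ∂(volume.restrict (Ioc a b)), x ≠ b :=
      ae_restrict_of_ae (by simp [ae_iff])
    filter_upwards [hK.prod_right_ae, hne, self_mem_ae_restrict measurableSet_Ioc]
      with x hx hxb hxm
    have hx' : x ∈ Ioo a b := ⟨hxm.1, lt_of_le_of_ne hxm.2 hxb⟩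
    rw [integral_Ioi_of_hasDerivAt_of_tendsto (hG x hx') (hG' x hx') hx (hGt x hx'), zero_sub]
  rw [← h2, h1]
  apply integral_congr_ae
  filter_upwards [hK.prod_left_ae, self_mem_ae_restrict measurableSet_Ioi] with r hr hr0
  rw [← intervalIntegral.integral_of_le hab]
  symm
  exact intervalIntegral.integral_eq_sub_of_hasDerivAt_of_le hab (hF r hr0) (hF' r hr0)
    ((intervalIntegrable_iff_integrableOn_Ioc_of_le hab).2 hr)

/-- `f` is holomorphic on the slit plane with derivative `f'`, with a singularity of order at most
`ρ` at the origin and growth at most `exp (t * Re s + ε * |s|)`. -/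
structure ContourBound (f f' : ℂ → ℂ) (t ε ρ C : ℝ) : Prop where
  hasDerivAt : ∀ s ∈ Complex.slitPlane, HasDerivAt f (f' s) s
  measurable : Measurable f
  measurable_deriv : Measurable f'
  norm_le : ∀ s, s ≠ 0 → ‖f s‖ ≤ C * (Real.exp (t * s.re + ε * ‖s‖) * ‖s‖ ^ (-ρ))
  norm_deriv_le : ∀ s, s ≠ 0 → ‖f' s‖ ≤ C * (Real.exp (t * s.re + ε * ‖s‖) * ‖s‖ ^ (-ρ - 1))

theorem ContourBound.nonneg {f f' : ℂ → ℂ} {t ε ρ C : ℝ} (h : ContourBound f f' t ε ρ C) :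
    0 ≤ C := by
  have := (norm_nonneg _).trans (h.norm_le 1 one_ne_zero)
  exact nonneg_of_mul_nonneg_left this (by simp; positivity)

/-- The unit vector of angle `θ`. -/
def ray (θ : ℝ) : ℂ := Complex.exp (θ * Complex.I)

theorem norm_ray (θ : ℝ) : ‖ray θ‖ = 1 := Complex.norm_exp_ofReal_mul_I θ

theorem ray_ne_zero (θ : ℝ) : ray θ ≠ 0 := Complex.exp_ne_zero _

theorem ray_re (θ : ℝ) : (ray θ).re = Real.cos θ := Complex.exp_ofReal_mul_I_re θ

theorem ray_im (θ : ℝ) : (ray θ).im = Real.sin θ := Complex.exp_ofReal_mul_I_im θ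

theorem continuous_ray : Continuous ray := by unfold ray; fun_prop

theorem hasDerivAt_ray (θ : ℝ) : HasDerivAt ray (ray θ * Complex.I) θ := by
  unfold ray
  simpa using ((Complex.ofRealCLM.hasDerivAt (x := θ)).mul_const Complex.I).cexp

/-- The imaginary part of x + r e^(iθ) is r sin θ; after rotation by -θ it is -x sin θ. Both are
bounded by the modulus. -/
theorem sin_mul_le_norm_add_mul_ray {θ x r : ℝ} (hθ : 0 ≤ Real.sin θ) (hx : 0 ≤ x) (hr : 0 ≤ r) :
    Real.sin θ * x ≤ ‖(x : ℂ) + r * ray θ‖ ∧ Real.sin θ * r ≤ ‖(x : ℂ) + r * ray θ‖ := by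
  constructor
  · have h : ‖(x : ℂ) + r * ray θ‖ = ‖(x : ℂ) * ray (-θ) + r‖ := by
      have h1 : ray θ * ray (-θ) = 1 := by
        rw [ray, ray, ← Complex.exp_add]; simp
      calc ‖(x : ℂ) + r * ray θ‖ = ‖((x : ℂ) + r * ray θ) * ray (-θ)‖ := by
            rw [norm_mul, norm_ray, mul_one]
        _ = _ := by congr 1; linear_combination r * h1
    rw [h]
    refine le_trans (le_of_eq ?_) (Complex.abs_im_le_norm _)
    simp [ray_im, abs_mul, abs_of_nonneg hθ, abs_of_nonneg hx, mul_comm]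
  · refine le_trans (le_of_eq ?_) (Complex.abs_im_le_norm _)
    simp [ray_im, abs_mul, abs_of_nonneg hθ, abs_of_nonneg hr, mul_comm]

theorem norm_add_mul_ray_le {θ x r : ℝ} (hx : 0 ≤ x) (hr : 0 ≤ r) :
    ‖(x : ℂ) + r * ray θ‖ ≤ x + r := by
  refine (norm_add_le _ _).trans ?_
  rw [norm_mul, norm_ray, Complex.norm_real, Complex.norm_real, Real.norm_of_nonneg hx,
    Real.norm_of_nonneg hr, mul_one]

theorem add_mul_ray_re (θ x r : ℝ) : ((x : ℂ) + r * ray θ).re = x + r * Real.cos θ := by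
  simp [ray_re]

theorem add_mul_ray_mem_slitPlane {θ x r : ℝ} (hθ : 0 < Real.sin θ) (_hx : 0 ≤ x) (hr : 0 ≤ r)
    (hxr : 0 < x ∨ 0 < r) : (x : ℂ) + r * ray θ ∈ Complex.slitPlane := by
  rcases hr.eq_or_lt with rfl | hr
  · simpa using hxr
  · rw [Complex.mem_slitPlane_iff]
    right
    simp [ray_im, hθ.ne', hr.ne']

theorem tendsto_rpow_mul_exp_neg_atTop (p : ℝ) {d : ℝ} (hd : 0 < d) (C : ℝ) :
    Tendsto (fun r : ℝ => C * (r ^ p * Real.exp (-(d * r)))) atTop (𝓝 0) := by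
  simpa using (tendsto_rpow_mul_exp_neg_mul_atTop_nhds_zero p d hd).const_mul C

theorem ContourBound.norm_add_mul_ray_le {f f' : ℂ → ℂ} {t ε ρ C θ : ℝ}
    (h : ContourBound f f' t ε ρ C) (ht : 0 < t) (hε : 0 ≤ ε) (hρ : 0 ≤ ρ)
    (hθ : 0 < Real.sin θ) {x r : ℝ} (hx : 0 ≤ x) (hx1 : x ≤ 1) (hr : 0 < r) :
    ‖f (x + r * ray θ)‖ ≤ C * Real.exp (t + ε) * Real.sin θ ^ (-ρ) *
      (r ^ (-ρ) * Real.exp (-((-t * Real.cos θ - ε) * r))) := by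
  have hs := Complex.slitPlane_ne_zero (add_mul_ray_mem_slitPlane hθ hx hr.le (Or.inr hr))
  have hC := h.nonneg
  have h1 := (sin_mul_le_norm_add_mul_ray hθ.le hx hr.le).2
  have h2 := EfrosWright.norm_add_mul_ray_le (θ := θ) hx hr.le
  have h3 : ‖(x : ℂ) + r * ray θ‖ ^ (-ρ) ≤ Real.sin θ ^ (-ρ) * r ^ (-ρ) := by
    rw [← Real.mul_rpow hθ.le hr.le]
    exact Real.rpow_le_rpow_of_nonpos (by positivity) h1 (by linarith)
  have h4 : Real.exp (t * ((x : ℂ) + r * ray θ).re + ε * ‖(x : ℂ) + r * ray θ‖) ≤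
      Real.exp (t + ε) * Real.exp (-((-t * Real.cos θ - ε) * r)) := by
    rw [← Real.exp_add, add_mul_ray_re]
    apply Real.exp_le_exp.2
    nlinarith
  calc _ ≤ _ := h.norm_le _ hs
    _ ≤ C * ((Real.exp (t + ε) * Real.exp (-((-t * Real.cos θ - ε) * r))) *
        (Real.sin θ ^ (-ρ) * r ^ (-ρ))) := by gcongr
    _ = _ := by ring

theorem ContourBound.integrableOn_add_mul_ray {f f' : ℂ → ℂ} {t ε ρ C θ : ℝ}
    (h : ContourBound f f' t ε ρ C) (ht : 0 < t) (hε : 0 ≤ ε) (hρ : 0 ≤ ρ) (hρ1 : ρ < 1)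
    (hθ : 0 < Real.sin θ) (hd : 0 < -t * Real.cos θ - ε) {x : ℝ} (hx : 0 ≤ x) (hx1 : x ≤ 1) :
    IntegrableOn (fun r : ℝ => f (x + r * ray θ) * ray θ) (Ioi 0) := by
  refine Integrable.mono' ((integrableOn_rpow_mul_exp_neg (p := -ρ) (by linarith) hd).const_mul
    (C * Real.exp (t + ε) * Real.sin θ ^ (-ρ))) ?_ ?_
  · apply Measurable.aestronglyMeasurable
    exact (h.measurable.comp (by fun_prop)).mul_const _
  · filter_upwards [self_mem_ae_restrict measurableSet_Ioi] with r hr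
    rw [norm_mul, norm_ray, mul_one]
    exact h.norm_add_mul_ray_le ht hε hρ hθ hx hx1 hr

/-- Moving the apex of a ray from `0` to `1`. -/
theorem ContourBound.integral_one_add_sub {f f' : ℂ → ℂ} {t ε ρ C θ : ℝ}
    (h : ContourBound f f' t ε ρ C) (ht : 0 < t) (hε : 0 ≤ ε) (hρ : 0 ≤ ρ) (hρ1 : ρ < 1)
    (hθ : 0 < Real.sin θ) (hd : 0 < -t * Real.cos θ - ε) :
    ∫ r in Ioi (0 : ℝ), f (((1 : ℝ) : ℂ) + (r : ℂ) * ray θ) * ray θ -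
        f (((0 : ℝ) : ℂ) + (r : ℂ) * ray θ) * ray θ = -∫ x in (0 : ℝ)..1, f x := by
  have hC := h.nonneg
  have hder : ∀ x r : ℝ, 0 ≤ x → 0 < r →
      HasDerivAt f (f' (x + r * ray θ)) (x + r * ray θ) := fun x r hx hr =>
    h.hasDerivAt _ (add_mul_ray_mem_slitPlane hθ hx hr.le (Or.inr hr))
  have hx_der : ∀ x r : ℝ, HasDerivAt (fun x : ℝ => (x : ℂ) + r * ray θ) 1 x := fun x r =>
    (Complex.ofRealCLM.hasDerivAt (x := x)).add_const _
  have hr_der : ∀ x r : ℝ, HasDerivAt (fun r : ℝ => (x : ℂ) + r * ray θ) (ray θ) r := fun x r => by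
    simpa using ((Complex.ofRealCLM.hasDerivAt (x := r)).mul_const (ray θ)).const_add (x : ℂ)
  have key := integral_Ioi_sub_eq_neg_of_mixed_deriv (zero_le_one (α := ℝ))
    (F := fun x r => f (x + r * ray θ) * ray θ) (G := fun x r => f (x + r * ray θ))
    (K := fun x r => f' (x + r * ray θ) * ray θ) ?_ ?_ ?_ ?_ ?_ ?_
  · simpa using key
  · set q := (ρ + 1) / 2 with hq
    have hi1 : IntegrableOn (fun x : ℝ => x ^ (-q)) (Ioc 0 1) := by
      rw [← intervalIntegrable_iff_integrableOn_Ioc_of_le zero_le_one]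
      exact intervalIntegral.intervalIntegrable_rpow' (by linarith)
    have hi2 := integrableOn_rpow_mul_exp_neg (p := -q) (by linarith) hd
    refine Integrable.mono' ((hi1.mul_prod hi2).const_mul
      (C * Real.exp (t + ε) * Real.sin θ ^ (-ρ - 1))) ?_ ?_
    · apply Measurable.aestronglyMeasurable
      exact (h.measurable_deriv.comp (by fun_prop)).mul_const _
    · rw [Measure.prod_restrict]
      filter_upwards [self_mem_ae_restrict (measurableSet_Ioc.prod measurableSet_Ioi)] with z hz
      obtain ⟨x, r⟩ := z
      obtain ⟨⟨hx0, hx1⟩, hr⟩ := hz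
      simp only at hx0 hx1
      have hr : 0 < r := hr
      simp only [Function.uncurry]
      rw [norm_mul, norm_ray, mul_one]
      have hs := Complex.slitPlane_ne_zero (add_mul_ray_mem_slitPlane hθ hx0.le hr.le (Or.inr hr))
      have hs' := norm_pos_iff.2 hs
      have h1 := sin_mul_le_norm_add_mul_ray hθ.le hx0.le hr.le
      have h2 := EfrosWright.norm_add_mul_ray_le (θ := θ) hx0.le hr.le
      have h3 : ‖(x : ℂ) + r * ray θ‖ ^ (-ρ - 1) ≤
          Real.sin θ ^ (-ρ - 1) * (x ^ (-q) * r ^ (-q)) := by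
        calc ‖(x : ℂ) + r * ray θ‖ ^ (-ρ - 1)
            = ‖(x : ℂ) + r * ray θ‖ ^ (-q) * ‖(x : ℂ) + r * ray θ‖ ^ (-q) := by
              rw [← Real.rpow_add hs']; congr 1; rw [hq]; ring
          _ ≤ (Real.sin θ * x) ^ (-q) * (Real.sin θ * r) ^ (-q) := by
              gcongr ?_ * ?_
              · exact Real.rpow_le_rpow_of_nonpos (by positivity) h1.1 (by linarith)
              · exact Real.rpow_le_rpow_of_nonpos (by positivity) h1.2 (by linarith)
          _ = _ := by
              rw [Real.mul_rpow hθ.le hx0.le, Real.mul_rpow hθ.le hr.le,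
                show -ρ - 1 = -q + -q by rw [hq]; ring, Real.rpow_add hθ]
              ring
      have h4 : Real.exp (t * ((x : ℂ) + r * ray θ).re + ε * ‖(x : ℂ) + r * ray θ‖) ≤
          Real.exp (t + ε) * Real.exp (-((-t * Real.cos θ - ε) * r)) := by
        rw [← Real.exp_add, add_mul_ray_re]
        apply Real.exp_le_exp.2
        nlinarith
      calc _ ≤ _ := h.norm_deriv_le _ hs
        _ ≤ C * ((Real.exp (t + ε) * Real.exp (-((-t * Real.cos θ - ε) * r))) *
            (Real.sin θ ^ (-ρ - 1) * (x ^ (-q) * r ^ (-q)))) := by gcongr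
        _ = _ := by ring
  · intro r hr x hx
    apply ContinuousAt.continuousWithinAt
    have := (hder x r hx.1 hr).continuousAt
    exact (ContinuousAt.comp (f := fun x : ℝ => (x : ℂ) + r * ray θ) this
      (hx_der x r).continuousAt).mul continuousAt_const
  · intro r hr x hx
    have := ((hder x r hx.1.le hr).comp x (hx_der x r)).mul_const (ray θ)
    simpa [Function.comp_def] using this
  · intro x hx
    apply ContinuousAt.continuousWithinAt
    have h1 := (h.hasDerivAt _ (add_mul_ray_mem_slitPlane (x := x) (r := 0) hθ hx.1.le le_rfl
      (Or.inl hx.1))).continuousAt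
    exact ContinuousAt.comp (f := fun r : ℝ => (x : ℂ) + r * ray θ) h1 (hr_der x 0).continuousAt
  · intro x hx r hr
    exact (hder x r hx.1.le hr).comp r (hr_der x r)
  · intro x hx
    refine squeeze_zero_norm' ?_ (tendsto_rpow_mul_exp_neg_atTop (-ρ) hd
      (C * Real.exp (t + ε) * Real.sin θ ^ (-ρ)))
    filter_upwards [eventually_gt_atTop 0] with r hr
    exact h.norm_add_mul_ray_le ht hε hρ hθ hx.1.le hx.2.le hr

theorem ContourBound.norm_mul_ray_le {f f' : ℂ → ℂ} {t ε ρ C θ φ : ℝ}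
    (h : ContourBound f f' t ε ρ C) (ht : 0 < t) (hφ : Real.cos φ ≤ Real.cos θ)
    {r : ℝ} (hr : 0 < r) :
    ‖f (r * ray φ)‖ ≤ C * (r ^ (-ρ) * Real.exp (-((-t * Real.cos θ - ε) * r))) ∧
    ‖f' (r * ray φ)‖ ≤ C * (r ^ (-ρ - 1) * Real.exp (-((-t * Real.cos θ - ε) * r))) := by
  have hs : (r : ℂ) * ray φ ≠ 0 := mul_ne_zero (by exact_mod_cast hr.ne') (ray_ne_zero φ)
  have hC := h.nonneg
  have h2 : ‖(r : ℂ) * ray φ‖ = r := by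
    rw [norm_mul, norm_ray, mul_one, Complex.norm_real, Real.norm_of_nonneg hr.le]
  have h4 : Real.exp (t * ((r : ℂ) * ray φ).re + ε * ‖(r : ℂ) * ray φ‖) ≤
      Real.exp (-((-t * Real.cos θ - ε) * r)) := by
    rw [h2]
    apply Real.exp_le_exp.2
    simp only [Complex.re_ofReal_mul, ray_re]
    nlinarith [mul_le_mul_of_nonneg_left hφ (mul_pos ht hr).le]
  have h5 := h.norm_le _ hs
  have h6 := h.norm_deriv_le _ hs
  rw [h2] at h5 h6 h4
  constructor
  · refine h5.trans ?_
    rw [mul_comm (r ^ (-ρ))]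
    gcongr
  · refine h6.trans ?_
    rw [mul_comm (r ^ (-ρ - 1))]
    gcongr

theorem ContourBound.integrableOn_mul_ray {f f' : ℂ → ℂ} {t ε ρ C φ : ℝ}
    (h : ContourBound f f' t ε ρ C) (ht : 0 < t) (hρ1 : ρ < 1) (hd : 0 < -t * Real.cos φ - ε) :
    IntegrableOn (fun r : ℝ => f (r * ray φ)) (Ioi 0) := by
  refine Integrable.mono' ((integrableOn_rpow_mul_exp_neg (p := -ρ) (by linarith) hd).const_mul
    C) ?_ ?_
  · apply Measurable.aestronglyMeasurable
    exact h.measurable.comp (by fun_prop)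
  · filter_upwards [self_mem_ae_restrict measurableSet_Ioi] with r hr
    exact (h.norm_mul_ray_le ht le_rfl hr).1

/-- Rotating a ray from `0` to the upper edge of the negative real axis. -/
theorem ContourBound.integral_ray_sub {f f' : ℂ → ℂ} {t ε ρ C θ : ℝ}
    (h : ContourBound f f' t ε ρ C) (ht : 0 < t) (hρ1 : ρ < 1)
    (hθ0 : 0 < θ) (hθπ : θ < Real.pi) (hd : 0 < -t * Real.cos θ - ε)
    (hcont : ∀ r : ℝ, 0 < r → ContinuousOn (fun φ : ℝ => f (r * ray φ)) (Icc θ Real.pi)) :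
    ∫ r in Ioi (0 : ℝ), f (r * ray Real.pi) * ray Real.pi - f (r * ray θ) * ray θ = 0 := by
  have hC := h.nonneg
  have hcos : ∀ φ, θ ≤ φ → φ ≤ Real.pi → Real.cos φ ≤ Real.cos θ := fun φ h1 h2 =>
    Real.cos_le_cos_of_nonneg_of_le_pi hθ0.le h2 h1
  have hder : ∀ φ r : ℝ, φ ∈ Ioo θ Real.pi → 0 < r →
      HasDerivAt f (f' (r * ray φ)) (r * ray φ) := fun φ r hφ hr => by
    apply h.hasDerivAt
    have := add_mul_ray_mem_slitPlane (θ := φ) (x := 0) (r := r)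
      (Real.sin_pos_of_pos_of_lt_pi (hθ0.trans hφ.1) hφ.2) le_rfl hr.le (Or.inr hr)
    simpa using this
  have hx_der : ∀ φ r : ℝ, HasDerivAt (fun φ : ℝ => (r : ℂ) * ray φ)
      (r * (ray φ * Complex.I)) φ := fun φ r => (hasDerivAt_ray φ).const_mul _
  have hr_der : ∀ φ r : ℝ, HasDerivAt (fun r : ℝ => (r : ℂ) * ray φ) (ray φ) r := fun φ r => by
    simpa using ((Complex.ofRealCLM.hasDerivAt (x := r)).mul_const (ray φ))
  have hG : ∀ φ ∈ Ioo θ Real.pi, ∀ r : ℝ, 0 < r →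
      ‖f (r * ray φ) * (r * (ray φ * Complex.I))‖ ≤
        C * (r ^ (1 - ρ) * Real.exp (-((-t * Real.cos θ - ε) * r))) := by
    intro φ hφ r hr
    rw [norm_mul, norm_mul, norm_mul, norm_ray, Complex.norm_I, Complex.norm_real,
      Real.norm_of_nonneg hr.le, mul_one, mul_one, sub_eq_add_neg, Real.rpow_add hr, Real.rpow_one]
    calc _ ≤ C * (r ^ (-ρ) * Real.exp (-((-t * Real.cos θ - ε) * r))) * r := by
          gcongr
          exact (h.norm_mul_ray_le ht (hcos φ hφ.1.le hφ.2.le) hr).1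
      _ = _ := by ring
  have key := integral_Ioi_sub_eq_neg_of_mixed_deriv hθπ.le
    (F := fun φ r => f (r * ray φ) * ray φ)
    (G := fun φ r => f (r * ray φ) * (r * (ray φ * Complex.I)))
    (K := fun φ r => f' (r * ray φ) * (r * (ray φ * Complex.I)) * ray φ +
      f (r * ray φ) * (ray φ * Complex.I)) ?_ ?_ ?_ ?_ ?_ ?_
  · simpa using key
  · have hi1 : IntegrableOn (fun x : ℝ => (1 : ℝ)) (Ioc θ Real.pi) := by simp
    have hi2 := integrableOn_rpow_mul_exp_neg (p := -ρ) (by linarith) hd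
    refine Integrable.mono' ((hi1.mul_prod hi2).const_mul (2 * C)) ?_ ?_
    · apply Measurable.aestronglyMeasurable
      have hm : Measurable fun z : ℝ × ℝ => (z.2 : ℂ) * ray z.1 := by
        have := continuous_ray.measurable
        fun_prop
      have h1 := h.measurable_deriv.comp hm
      have h2 := h.measurable.comp hm
      have h3 : Measurable fun z : ℝ × ℝ => ray z.1 := continuous_ray.measurable.comp measurable_fst
      exact ((h1.mul ((Complex.measurable_ofReal.comp measurable_snd).mul
        (h3.mul_const _))).mul h3).add (h2.mul (h3.mul_const _))
    · rw [Measure.prod_restrict]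
      filter_upwards [self_mem_ae_restrict (measurableSet_Ioc.prod measurableSet_Ioi)] with z hz
      obtain ⟨φ, r⟩ := z
      obtain ⟨⟨hx0, hx1⟩, hr⟩ := hz
      have hr : 0 < r := hr
      obtain ⟨b1, b2⟩ := h.norm_mul_ray_le ht (hcos φ hx0.le hx1) hr
      simp only [Function.uncurry]
      refine (norm_add_le _ _).trans ?_
      simp only [norm_mul, norm_ray, Complex.norm_I, Complex.norm_real, Real.norm_of_nonneg hr.le,
        mul_one, one_mul]
      have e : r ^ (-ρ - 1) * r = r ^ (-ρ) := by
        rw [Real.rpow_sub_one hr.ne']; field_simp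
      calc _ ≤ C * (r ^ (-ρ - 1) * Real.exp (-((-t * Real.cos θ - ε) * r))) * r +
            C * (r ^ (-ρ) * Real.exp (-((-t * Real.cos θ - ε) * r))) := by gcongr
        _ = C * Real.exp (-((-t * Real.cos θ - ε) * r)) * (r ^ (-ρ - 1) * r) +
            C * (r ^ (-ρ) * Real.exp (-((-t * Real.cos θ - ε) * r))) := by ring
        _ = _ := by rw [e]; ring
  · intro r hr
    exact (hcont r hr).mul continuous_ray.continuousOn
  · intro r hr φ hφ
    exact ((hder φ r hφ hr).comp φ (hx_der φ r)).mul (hasDerivAt_ray φ)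
  · intro φ hφ
    -- The small arc contributes nothing: its length r beats the singularity r^(-ρ). At r = 0 itself
    -- the factor r gives the value 0 whatever f is there.
    have h0 : Tendsto (fun r : ℝ => C * (r ^ (1 - ρ) *
        Real.exp (-((-t * Real.cos θ - ε) * r)))) (𝓝[Ici 0] 0) (𝓝 0) := by
      have h1 : Continuous fun r : ℝ => C * (r ^ (1 - ρ) *
          Real.exp (-((-t * Real.cos θ - ε) * r))) := by
        have : Continuous fun r : ℝ => r ^ (1 - ρ) :=
          continuous_id.rpow_const fun _ => Or.inr (by linarith)
        fun_prop
      have h2 := (h1.tendsto 0).mono_left (nhdsWithin_le_nhds (s := Ici 0))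
      simpa [Real.zero_rpow (by linarith : 1 - ρ ≠ 0)] using h2
    rw [ContinuousWithinAt]
    simp only [Complex.ofReal_zero, zero_mul, mul_zero]
    refine squeeze_zero_norm' ?_ h0
    filter_upwards [self_mem_nhdsWithin] with r hr
    rcases (show (0 : ℝ) ≤ r from hr).eq_or_lt with rfl | hr
    · simp [Real.zero_rpow (by linarith : 1 - ρ ≠ 0)]
    · exact hG φ hφ r hr
  · intro φ hφ r hr
    have h1 := ((hder φ r hφ hr).comp r (hr_der φ r)).mul
      ((Complex.ofRealCLM.hasDerivAt (x := r)).mul_const (ray φ * Complex.I))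
    convert! h1 using 1
    simp only [Function.comp, Complex.ofRealCLM_apply, Complex.ofReal_one]
    ring
  · intro φ hφ
    refine squeeze_zero_norm' ?_ (tendsto_rpow_mul_exp_neg_atTop (1 - ρ) hd C)
    filter_upwards [eventually_gt_atTop 0] with r hr
    exact hG φ hφ r hr

/-- The contour integral along the ray of angle `θ` from `1` has the same imaginary part as that
along the upper edge of the negative real axis, if `f` is real on the positive half-line. -/
theorem ContourBound.integral_im_eq {f f' : ℂ → ℂ} {t ε ρ C θ : ℝ}
    (h : ContourBound f f' t ε ρ C) (ht : 0 < t) (hε : 0 ≤ ε) (hρ : 0 ≤ ρ) (hρ1 : ρ < 1)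
    (hθ0 : 0 < θ) (hθπ : θ < Real.pi) (hd : 0 < -t * Real.cos θ - ε)
    (hcont : ∀ r : ℝ, 0 < r → ContinuousOn (fun φ : ℝ => f (r * ray φ)) (Icc θ Real.pi))
    (hreal : ∀ x : ℝ, 0 < x → (f x).im = 0) :
    (∫ r in Ioi (0 : ℝ), f (1 + r * ray θ) * ray θ).im =
      ∫ r in Ioi (0 : ℝ), (-f (r * ray Real.pi)).im := by
  have hsin := Real.sin_pos_of_pos_of_lt_pi hθ0 hθπ
  have i1 := h.integrableOn_add_mul_ray ht hε hρ hρ1 hsin hd zero_le_one le_rfl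
  have i0 := h.integrableOn_add_mul_ray ht hε hρ hρ1 hsin hd le_rfl zero_le_one
  have e1 := h.integral_one_add_sub ht hε hρ hρ1 hsin hd
  have e2 := h.integral_ray_sub ht hρ1 hθ0 hθπ hd hcont
  have hcosπ : 0 < -t * Real.cos Real.pi - ε := by
    have := Real.cos_le_cos_of_nonneg_of_le_pi hθ0.le le_rfl hθπ.le
    nlinarith
  have iπ := (h.integrableOn_mul_ray ht hρ1 hcosπ).mul_const (ray Real.pi)
  -- Moving the apex from 0 to 1 costs the integral of f over [0, 1], which is real. If f is not
  -- integrable there, the default value 0 of the integral serves equally.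
  have im0 : (∫ x in (0 : ℝ)..1, f x).im = 0 := by
    rw [intervalIntegral.integral_of_le zero_le_one]
    by_cases hi : IntegrableOn (fun x : ℝ => f x) (Ioc 0 1)
    · have h1 := integral_im (𝕜 := ℂ) hi
      simp only [RCLike.im_to_complex] at h1
      rw [← h1]
      refine (setIntegral_congr_fun (g := fun _ => (0 : ℝ)) measurableSet_Ioc
        fun x hx => hreal x hx.1).trans ?_
      simp
    · rw [integral_undef hi]; simp
  rw [integral_sub i1 i0] at e1
  simp only [Complex.ofReal_zero, zero_add, Complex.ofReal_one] at e1 i0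
  rw [integral_sub iπ i0] at e2
  have e3 : ray Real.pi = -1 := Complex.exp_pi_mul_I
  have h1 := integral_im (𝕜 := ℂ) iπ
  simp only [RCLike.im_to_complex] at h1
  calc _ = (∫ r in Ioi (0 : ℝ), f (r * ray Real.pi) * ray Real.pi).im := by
        have h2 := congrArg Complex.im e1
        have h3 := congrArg Complex.im e2
        simp only [Complex.sub_im, Complex.neg_im, Complex.zero_im] at h2 h3
        linarith
    _ = _ := by rw [← h1]; simp [e3]

/-! ### Bounds for the contour integrand and its boundary values -/

/-- Weighted arithmetic-geometric mean inequality for u and B, where B is chosen so that B^(1-a) =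
y/ε. -/
theorem exists_mul_rpow_le_mul_add {a y ε : ℝ} (ha : 0 < a) (ha1 : a < 1) (hy : 0 ≤ y)
    (hε : 0 < ε) : ∃ C : ℝ, ∀ u : ℝ, 0 ≤ u → y * u ^ a ≤ ε * u + C := by
  set B := (y / ε) ^ (1 / (1 - a)) with hB
  have hB0 : 0 ≤ B := by positivity
  refine ⟨ε * B, fun u hu => ?_⟩
  have h1 := Real.geom_mean_le_arith_mean2_weighted ha.le (by linarith : 0 ≤ 1 - a) hu hB0
    (by ring)
  have h2 : B ^ (1 - a) = y / ε := by
    rw [hB, ← Real.rpow_mul (by positivity), one_div, inv_mul_cancel₀ (by linarith), Real.rpow_one]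
  rw [h2] at h1
  have h3 : u ^ a * (y / ε) ≤ u + B := h1.trans (by nlinarith)
  calc y * u ^ a = ε * (u ^ a * (y / ε)) := by field_simp
    _ ≤ ε * (u + B) := by gcongr
    _ = _ := by ring

theorem exists_rpow_le_mul_exp {p ε : ℝ} (hp : 0 ≤ p) (hε : 0 < ε) :
    ∃ C : ℝ, 0 ≤ C ∧ ∀ u : ℝ, 0 ≤ u → u ^ p ≤ C * Real.exp (ε * u) := by
  -- The shift keeps k positive when p = 0, so that dividing by k is legitimate.
  set k := p + 1 with hk
  refine ⟨(k / ε) ^ k + 1, by positivity, fun u hu => ?_⟩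
  rcases le_total u 1 with h | h
  · have h1 : u ^ p ≤ 1 := Real.rpow_le_one hu h hp
    have h2 : 1 ≤ Real.exp (ε * u) := Real.one_le_exp (by positivity)
    have h3 : 0 ≤ (k / ε) ^ k := by positivity
    nlinarith
  · have hk0 : 0 < k := by positivity
    have h1 : ε * u / k ≤ Real.exp (ε * u / k) := by
      linarith [Real.add_one_le_exp (ε * u / k)]
    have h2 : u ≤ k / ε * Real.exp (ε * u / k) := by
      calc u = k / ε * (ε * u / k) := by field_simp
        _ ≤ _ := by gcongr
    calc u ^ p ≤ u ^ k := Real.rpow_le_rpow_of_exponent_le h (by linarith)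
      _ ≤ (k / ε * Real.exp (ε * u / k)) ^ k := Real.rpow_le_rpow hu h2 hk0.le
      _ = (k / ε) ^ k * Real.exp (ε * u) := by
        rw [Real.mul_rpow (by positivity) (by positivity), ← Real.exp_mul,
          div_mul_cancel₀ _ hk0.ne']
      _ ≤ _ := by gcongr; linarith

/-- Half of ε absorbs the subexponential factor e^(y u^a), the other half the surplus power u^(p+ρ);
only the singularity u^(-ρ) remains. -/
theorem exists_rpow_mul_exp_rpow_le {a y ε p ρ : ℝ} (ha : 0 < a) (ha1 : a < 1) (hy : 0 ≤ y)
    (hε : 0 < ε) (hp : -ρ ≤ p) : ∃ C : ℝ, 0 ≤ C ∧ ∀ u : ℝ, 0 < u →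
      u ^ p * Real.exp (y * u ^ a) ≤ C * (Real.exp (ε * u) * u ^ (-ρ)) := by
  obtain ⟨C1, h1⟩ := exists_mul_rpow_le_mul_add ha ha1 hy (half_pos hε)
  obtain ⟨C2, h20, h2⟩ := exists_rpow_le_mul_exp (by linarith : 0 ≤ p + ρ) (half_pos hε)
  refine ⟨C2 * Real.exp C1, by positivity, fun u hu => ?_⟩
  have e1 : u ^ p = u ^ (p + ρ) * u ^ (-ρ) := by rw [← Real.rpow_add hu]; congr 1; ring
  have e2 : Real.exp (ε * u) = Real.exp (ε / 2 * u) * Real.exp (ε / 2 * u) := by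
    rw [← Real.exp_add]; congr 1; ring
  have h3 : Real.exp (y * u ^ a) ≤ Real.exp (ε / 2 * u) * Real.exp C1 := by
    rw [← Real.exp_add]; exact Real.exp_le_exp.2 (h1 u hu.le)
  rw [e1, e2]
  calc _ ≤ C2 * Real.exp (ε / 2 * u) * u ^ (-ρ) * (Real.exp (ε / 2 * u) * Real.exp C1) := by
        gcongr
        exact h2 u hu.le
    _ = _ := by ring

/-- The function `e ^ (t s) s ^ (-b) (e ^ (-y s ^ a) - κ)`. -/
def contourFun (b κ a t y : ℝ) (s : ℂ) : ℂ :=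
  Complex.exp (t * s) * s ^ ((-b : ℝ) : ℂ) * (Complex.exp (-(y * s ^ (a : ℂ))) - κ)

/-- The derivative of `contourFun`. -/
def contourDeriv (b κ a t y : ℝ) (s : ℂ) : ℂ :=
  Complex.exp (t * s) * (t * s ^ ((-b : ℝ) : ℂ) * (Complex.exp (-(y * s ^ (a : ℂ))) - κ) +
    (-b : ℝ) * s ^ ((-b - 1 : ℝ) : ℂ) * (Complex.exp (-(y * s ^ (a : ℂ))) - κ) -
    y * a * (s ^ ((-b : ℝ) : ℂ) * s ^ ((a - 1 : ℝ) : ℂ)) * Complex.exp (-(y * s ^ (a : ℂ))))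

theorem hasDerivAt_contourFun (b κ a t y : ℝ) {s : ℂ} (hs : s ∈ Complex.slitPlane) :
    HasDerivAt (contourFun b κ a t y) (contourDeriv b κ a t y s) s := by
  have h1 : HasDerivAt (fun s : ℂ => Complex.exp (t * s)) (Complex.exp (t * s) * t) s := by
    simpa using ((hasDerivAt_id s).const_mul (t : ℂ)).cexp
  have h2 : ∀ c : ℝ, HasDerivAt (fun s : ℂ => s ^ (c : ℂ)) (c * s ^ ((c - 1 : ℝ) : ℂ)) s := by
    intro c
    simpa using (hasDerivAt_id s).cpow_const (c := (c : ℂ)) hs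
  have h3 := (((h2 a).const_mul (y : ℂ)).neg.cexp).sub_const (κ : ℂ)
  convert! (h1.mul (h2 (-b))).mul h3 using 1
  simp only [contourDeriv, Pi.mul_apply, Pi.neg_apply]
  ring

theorem norm_exp_neg_rpow_le {a y : ℝ} (hy : 0 ≤ y) (s : ℂ) :
    ‖Complex.exp (-(y * s ^ (a : ℂ)))‖ ≤ Real.exp (y * ‖s‖ ^ a) := by
  refine (Complex.norm_exp_le_exp_norm _).trans (le_of_eq ?_)
  rw [norm_neg, norm_mul, Complex.norm_cpow_real, Complex.norm_real, Real.norm_of_nonneg hy]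

/-- For κ = 1 the subtraction removes the value of the exponential at s = 0 and gains a factor
|s|^a. This brings the singularity s^(-1) of the case b = 1 down to an integrable order. -/
theorem norm_exp_neg_rpow_sub_le {κ a y : ℝ} (hκ : κ = 0 ∨ κ = 1) (hy : 0 ≤ y) (s : ℂ) :
    ‖Complex.exp (-(y * s ^ (a : ℂ))) - κ‖ ≤
      (1 + y) * (‖s‖ ^ (κ * a) * Real.exp (y * ‖s‖ ^ a)) := by
  have hE := Real.exp_pos (y * ‖s‖ ^ a)
  rcases hκ with rfl | rfl
  · have := norm_exp_neg_rpow_le (a := a) hy s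
    simp only [Complex.ofReal_zero, sub_zero, zero_mul, Real.rpow_zero, one_mul]
    nlinarith
  · have h1 := Complex.norm_exp_sub_sum_le_norm_mul_exp (-(y * s ^ (a : ℂ))) 1
    have h2 : ‖-((y : ℂ) * s ^ (a : ℂ))‖ = y * ‖s‖ ^ a := by
      rw [norm_neg, norm_mul, Complex.norm_cpow_real, Complex.norm_real, Real.norm_of_nonneg hy]
    rw [h2] at h1
    simp only [Finset.range_one, Finset.sum_singleton, pow_zero, Nat.factorial_zero, Nat.cast_one,
      div_one, pow_one] at h1
    simp only [Complex.ofReal_one, one_mul]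
    refine h1.trans ?_
    have : 0 ≤ ‖s‖ ^ a * Real.exp (y * ‖s‖ ^ a) := by positivity
    nlinarith

theorem exists_contourBound {b κ a t y ε ρ : ℝ} (hκ : κ = 0 ∨ κ = 1) (ha : 0 < a) (ha1 : a < 1)
    (ht : 0 < t) (hy : 0 ≤ y) (hε : 0 < ε) (hρ : b - κ * a ≤ ρ) :
    ∃ C, ContourBound (contourFun b κ a t y) (contourDeriv b κ a t y) t ε ρ C := by
  have hκ1 : κ * a ≤ a := by rcases hκ with rfl | rfl <;> simp [ha.le]
  -- C1 serves the function itself; C2, C3 and C4 serve the three terms of its derivative.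
  obtain ⟨C1, hC1, h1⟩ := exists_rpow_mul_exp_rpow_le (p := -b + κ * a) (ρ := ρ) ha ha1 hy hε
    (by linarith)
  obtain ⟨C2, hC2, h2⟩ := exists_rpow_mul_exp_rpow_le (p := -b + κ * a) (ρ := ρ + 1) ha ha1 hy hε
    (by linarith)
  obtain ⟨C3, hC3, h3⟩ := exists_rpow_mul_exp_rpow_le (p := -b - 1 + κ * a) (ρ := ρ + 1) ha ha1 hy
    hε (by linarith)
  obtain ⟨C4, hC4, h4⟩ := exists_rpow_mul_exp_rpow_le (p := -b + (a - 1)) (ρ := ρ + 1) ha ha1 hy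
    hε (by linarith)
  have hn : ∀ s : ℂ, ‖Complex.exp (t * s)‖ = Real.exp (t * s.re) := fun s => by
    rw [Complex.norm_exp, Complex.re_ofReal_mul]
  have hρ' : -(ρ + 1) = -ρ - 1 := by ring
  rw [hρ'] at h2 h3 h4
  set D := t * (1 + y) * C2 + |b| * (1 + y) * C3 + y * a * C4 with hD
  have hD0 : 0 ≤ D := by positivity
  refine ⟨(1 + y) * C1 + D, fun s hs => hasDerivAt_contourFun b κ a t y hs, ?_, ?_,
    fun s hs => ?_, fun s hs => ?_⟩
  · unfold contourFun; fun_prop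
  · unfold contourDeriv; fun_prop
  · have hs' := norm_pos_iff.2 hs
    have hh := norm_exp_neg_rpow_sub_le (a := a) hκ hy s
    rw [contourFun, norm_mul, norm_mul, hn, Complex.norm_cpow_real]
    calc _ ≤ Real.exp (t * s.re) * ‖s‖ ^ (-b) *
          ((1 + y) * (‖s‖ ^ (κ * a) * Real.exp (y * ‖s‖ ^ a))) := by gcongr
      _ = Real.exp (t * s.re) * (1 + y) * (‖s‖ ^ (-b + κ * a) * Real.exp (y * ‖s‖ ^ a)) := by
          rw [Real.rpow_add hs']; ring
      _ ≤ Real.exp (t * s.re) * (1 + y) * (C1 * (Real.exp (ε * ‖s‖) * ‖s‖ ^ (-ρ))) := by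
          exact mul_le_mul_of_nonneg_left (h1 _ hs') (by positivity)
      _ = (1 + y) * C1 * (Real.exp (t * s.re + ε * ‖s‖) * ‖s‖ ^ (-ρ)) := by
          rw [Real.exp_add]; ring
      _ ≤ _ := by gcongr; linarith
  · have hs' := norm_pos_iff.2 hs
    have hh := norm_exp_neg_rpow_sub_le (a := a) hκ hy s
    have hh' := norm_exp_neg_rpow_le (a := a) hy s
    set E := Real.exp (ε * ‖s‖) * ‖s‖ ^ (-ρ - 1) with hE
    have b1 : ‖t * s ^ ((-b : ℝ) : ℂ) * (Complex.exp (-(y * s ^ (a : ℂ))) - κ)‖ ≤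
        t * (1 + y) * C2 * E := by
      rw [norm_mul, norm_mul, Complex.norm_cpow_real, Complex.norm_real, Real.norm_of_nonneg ht.le]
      calc _ ≤ t * ‖s‖ ^ (-b) * ((1 + y) * (‖s‖ ^ (κ * a) * Real.exp (y * ‖s‖ ^ a))) := by gcongr
        _ = t * (1 + y) * (‖s‖ ^ (-b + κ * a) * Real.exp (y * ‖s‖ ^ a)) := by
          rw [Real.rpow_add hs']; ring
        _ ≤ t * (1 + y) * (C2 * E) := mul_le_mul_of_nonneg_left (h2 _ hs') (by positivity)
        _ = _ := by ring
    have b2 : ‖(-b : ℝ) * s ^ ((-b - 1 : ℝ) : ℂ) * (Complex.exp (-(y * s ^ (a : ℂ))) - κ)‖ ≤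
        |b| * (1 + y) * C3 * E := by
      rw [norm_mul, norm_mul, Complex.norm_cpow_real, Complex.norm_real, Real.norm_eq_abs, abs_neg]
      calc _ ≤ |b| * ‖s‖ ^ (-b - 1) * ((1 + y) * (‖s‖ ^ (κ * a) * Real.exp (y * ‖s‖ ^ a))) := by
            gcongr
        _ = |b| * (1 + y) * (‖s‖ ^ (-b - 1 + κ * a) * Real.exp (y * ‖s‖ ^ a)) := by
          rw [Real.rpow_add hs']; ring
        _ ≤ |b| * (1 + y) * (C3 * E) := mul_le_mul_of_nonneg_left (h3 _ hs') (by positivity)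
        _ = _ := by ring
    have b3 : ‖y * a * (s ^ ((-b : ℝ) : ℂ) * s ^ ((a - 1 : ℝ) : ℂ)) *
        Complex.exp (-(y * s ^ (a : ℂ)))‖ ≤ y * a * C4 * E := by
      rw [norm_mul, norm_mul, norm_mul, norm_mul, Complex.norm_cpow_real, Complex.norm_cpow_real,
        Complex.norm_real, Complex.norm_real, Real.norm_of_nonneg hy, Real.norm_of_nonneg ha.le,
        ← Real.rpow_add hs']
      calc _ ≤ y * a * ‖s‖ ^ (-b + (a - 1)) * Real.exp (y * ‖s‖ ^ a) := by gcongr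
        _ = y * a * (‖s‖ ^ (-b + (a - 1)) * Real.exp (y * ‖s‖ ^ a)) := by ring
        _ ≤ y * a * (C4 * E) := mul_le_mul_of_nonneg_left (h4 _ hs') (by positivity)
        _ = _ := by ring
    rw [contourDeriv, norm_mul, hn]
    calc _ ≤ Real.exp (t * s.re) * (t * (1 + y) * C2 * E + |b| * (1 + y) * C3 * E +
          y * a * C4 * E) := by
          gcongr
          exact (norm_sub_le _ _).trans
            (add_le_add ((norm_add_le _ _).trans (add_le_add b1 b2)) b3)
      _ = D * (Real.exp (t * s.re + ε * ‖s‖) * ‖s‖ ^ (-ρ - 1)) := by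
          rw [Real.exp_add, hE]; ring
      _ ≤ _ := by
          gcongr
          have : 0 ≤ (1 + y) * C1 := by positivity
          linarith

theorem mul_ray_cpow {r φ : ℝ} (hr : 0 < r) (hφ : φ ∈ Ioc (-Real.pi) Real.pi) (c : ℝ) :
    ((r : ℂ) * ray φ) ^ (c : ℂ) = ((r ^ c : ℝ) : ℂ) * ray (c * φ) := by
  rw [Complex.cpow_def_of_ne_zero (mul_ne_zero (by exact_mod_cast hr.ne') (ray_ne_zero φ)),
    Complex.log_ofReal_mul hr (ray_ne_zero φ), ray, Complex.log_exp (by simpa using hφ.1)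
      (by simpa using hφ.2), ray, add_mul, Complex.exp_add, Real.rpow_def_of_pos hr]
  push_cast
  congr 2
  ring

/-- The principal argument equals π on the cut, so the polar form of the powers remains valid at φ =
π. It gives the boundary values from above, where holomorphy is not available. -/
theorem continuousOn_contourFun_ray (b κ a t y : ℝ) {θ r : ℝ} (hθ : 0 < θ) (hr : 0 < r) :
    ContinuousOn (fun φ : ℝ => contourFun b κ a t y (r * ray φ)) (Icc θ Real.pi) := by
  have h : ContinuousOn (fun φ : ℝ => Complex.exp (t * (r * ray φ)) *
      (((r ^ (-b) : ℝ) : ℂ) * ray (-b * φ)) *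
        (Complex.exp (-(y * (((r ^ a : ℝ) : ℂ) * ray (a * φ)))) - κ)) (Icc θ Real.pi) := by
    apply Continuous.continuousOn
    have := continuous_ray
    fun_prop
  refine h.congr fun φ hφ => ?_
  have hφ' : φ ∈ Ioc (-Real.pi) Real.pi := ⟨by linarith [hφ.1, Real.pi_pos], hφ.2⟩
  simp only [contourFun, mul_ray_cpow hr hφ']

/-- At s = r e^(iπ) the powers are r^(-b) e^(-iπb) and r^a e^(iπa). The subtracted term contributes
a multiple of κ sin(πb), which vanishes by hypothesis. -/
theorem neg_contourFun_ray_pi_im {b κ a t y r : ℝ} (hκ : κ * Real.sin (Real.pi * b) = 0)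
    (hr : 0 < r) :
    (-contourFun b κ a t y (r * ray Real.pi)).im = phiIntegrand a b t y r := by
  have hπ : Real.pi ∈ Ioc (-Real.pi) Real.pi := ⟨by linarith [Real.pi_pos], le_rfl⟩
  have e3 : ray Real.pi = -1 := Complex.exp_pi_mul_I
  have e4 : Complex.exp (t * (r * ray Real.pi)) = (Real.exp (-(r * t)) : ℂ) := by
    rw [e3]; push_cast; congr 1; ring
  have e5 : Complex.exp (-(y * (((r ^ a : ℝ) : ℂ) * ray (a * Real.pi)))) =
      (Real.exp (-(y * r ^ a * Real.cos (Real.pi * a))) : ℂ) *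
        ray (-(y * r ^ a * Real.sin (Real.pi * a))) := by
    have : ray (a * Real.pi) = (Real.cos (Real.pi * a) : ℂ) +
        (Real.sin (Real.pi * a) : ℂ) * Complex.I := by
      rw [ray, Complex.exp_mul_I]; push_cast; ring_nf
    rw [this, ray, Complex.ofReal_exp, ← Complex.exp_add]
    congr 1
    push_cast
    ring
  have e6 : contourFun b κ a t y (r * ray Real.pi) =
      ((Real.exp (-(r * t)) * r ^ (-b) * Real.exp (-(y * r ^ a * Real.cos (Real.pi * a))) : ℝ) : ℂ) *
        ray (-(y * r ^ a * Real.sin (Real.pi * a) + Real.pi * b)) -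
      ((Real.exp (-(r * t)) * r ^ (-b) * κ : ℝ) : ℂ) * ray (-(Real.pi * b)) := by
    have e7 : ray (-(y * r ^ a * Real.sin (Real.pi * a) + Real.pi * b)) =
        ray (-(y * r ^ a * Real.sin (Real.pi * a))) * ray (-(Real.pi * b)) := by
      rw [ray, ray, ray, ← Complex.exp_add]; congr 1; push_cast; ring
    rw [contourFun, mul_ray_cpow hr hπ, mul_ray_cpow hr hπ, e4, e5, e7,
      show -b * Real.pi = -(Real.pi * b) by ring]
    push_cast
    ring
  rw [e6, Complex.neg_im, Complex.sub_im, Complex.im_ofReal_mul, Complex.im_ofReal_mul, ray_im,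
    ray_im, Real.sin_neg, Real.sin_neg, phiIntegrand, Real.exp_add, Real.rpow_neg hr.le,
    Real.exp_neg, Real.exp_neg]
  have := (Real.rpow_pos_of_pos hr b).ne'
  have h2 := (Real.exp_pos (r * t)).ne'
  have h3 := (Real.exp_pos (y * r ^ a * Real.cos (Real.pi * a))).ne'
  have e8 : ∀ A : ℝ, A * κ * -Real.sin (Real.pi * b) = 0 := fun A => by
    linear_combination -A * hκ
  rw [e8]
  field_simp
  ring

theorem contourFun_ofReal_im (b κ a t y : ℝ) {x : ℝ} (hx : 0 < x) :
    (contourFun b κ a t y x).im = 0 := by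
  have : contourFun b κ a t y x =
      ((Real.exp (t * x) * x ^ (-b) * (Real.exp (-(y * x ^ a)) - κ) : ℝ) : ℂ) := by
    rw [contourFun, ← Complex.ofReal_cpow hx.le, ← Complex.ofReal_cpow hx.le]
    push_cast
    ring
  rw [this, Complex.ofReal_im]

/-- Both expressions of the inverse Laplace transform: along a ray of angle `θ` from `1`, and along
the edges of the negative real axis. -/
theorem phiIntegrand_contour {b κ a t y θ : ℝ} (hκ : κ = 0 ∨ κ = 1)
    (hκb : κ * Real.sin (Real.pi * b) = 0) (hb : b - κ * a < 1) (ha : 0 < a) (ha1 : a < 1)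
    (ht : 0 < t) (hy : 0 ≤ y) (hθ : Real.pi / 2 < θ) (hθπ : θ < Real.pi) :
    IntegrableOn (phiIntegrand a b t y) (Ioi 0) ∧
    IntegrableOn (fun r : ℝ => contourFun b κ a t y (1 + r * ray θ) * ray θ) (Ioi 0) ∧
    (∫ r in Ioi (0 : ℝ), contourFun b κ a t y (1 + r * ray θ) * ray θ).im =
      ∫ r in Ioi (0 : ℝ), phiIntegrand a b t y r := by
  have hθ0 : 0 < θ := by linarith [Real.pi_pos]
  have hcos : Real.cos θ < 0 := Real.cos_neg_of_pi_div_two_lt_of_lt hθ (by linarith)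
  -- ε is half the decay rate of e^(ts) along the ray, so half of the decay survives.
  have hε : 0 < -t * Real.cos θ / 2 := by nlinarith
  obtain ⟨C, h⟩ := exists_contourBound (ρ := max 0 (b - κ * a)) hκ ha ha1 ht hy hε
    (le_max_right _ _)
  have hρ1 : max 0 (b - κ * a) < 1 := max_lt one_pos hb
  have hd : 0 < -t * Real.cos θ - -t * Real.cos θ / 2 := by linarith
  have hdπ : 0 < -t * Real.cos Real.pi - -t * Real.cos θ / 2 := by
    rw [Real.cos_pi]
    nlinarith [Real.neg_one_le_cos θ]
  refine ⟨?_, ?_, ?_⟩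
  · have h1 : IntegrableOn (fun r : ℝ => (-contourFun b κ a t y (r * ray Real.pi)).im) (Ioi 0) :=
      (h.integrableOn_mul_ray ht hρ1 hdπ).neg.im
    exact h1.congr_fun (fun r hr => neg_contourFun_ray_pi_im hκb hr) measurableSet_Ioi
  · simpa using h.integrableOn_add_mul_ray ht hε.le (le_max_left _ _) hρ1
      (Real.sin_pos_of_pos_of_lt_pi hθ0 hθπ) hd zero_le_one le_rfl
  · rw [h.integral_im_eq ht hε.le (le_max_left _ _) hρ1 hθ0 hθπ hd
      (fun r hr => continuousOn_contourFun_ray b κ a t y hθ0 hr)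
      (fun x hx => contourFun_ofReal_im b κ a t y hx)]
    exact setIntegral_congr_fun measurableSet_Ioi fun r hr => neg_contourFun_ray_pi_im hκb hr

/-! ### The ray from 1 and Hankel's integral for 1/Γ -/

/-- The angle of the contour lies strictly between `π / 2` and `π`. -/
structure IsWedgeAngle (θ : ℝ) : Prop where
  gt : Real.pi / 2 < θ
  lt : θ < Real.pi

namespace IsWedgeAngle

variable {θ : ℝ}

theorem pos (h : IsWedgeAngle θ) : 0 < θ := by linarith [h.gt, Real.pi_pos]

theorem sin_pos (h : IsWedgeAngle θ) : 0 < Real.sin θ :=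
  Real.sin_pos_of_pos_of_lt_pi h.pos h.lt

theorem cos_neg (h : IsWedgeAngle θ) : Real.cos θ < 0 :=
  Real.cos_neg_of_pi_div_two_lt_of_lt h.gt (by linarith [h.lt, Real.pi_pos])

end IsWedgeAngle

/-- The point at distance `r` from `1` on the ray of angle `θ` from `1`. -/
def wedgePoint (θ r : ℝ) : ℂ := 1 + r * ray θ

theorem continuous_wedgePoint (θ : ℝ) : Continuous (wedgePoint θ) := by
  unfold wedgePoint; fun_prop

theorem wedgePoint_re (θ r : ℝ) : (wedgePoint θ r).re = 1 + r * Real.cos θ := by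
  simp [wedgePoint, ray_re]

theorem wedgePoint_mem_slitPlane {θ r : ℝ} (hθ : IsWedgeAngle θ) (hr : 0 ≤ r) :
    wedgePoint θ r ∈ Complex.slitPlane := by
  simpa [wedgePoint] using
    add_mul_ray_mem_slitPlane (x := 1) hθ.sin_pos zero_le_one hr (Or.inl one_pos)

theorem wedgePoint_ne_zero {θ r : ℝ} (hθ : IsWedgeAngle θ) (hr : 0 ≤ r) : wedgePoint θ r ≠ 0 :=
  Complex.slitPlane_ne_zero (wedgePoint_mem_slitPlane hθ hr)

theorem sin_le_norm_wedgePoint {θ r : ℝ} (hθ : IsWedgeAngle θ) (hr : 0 ≤ r) :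
    Real.sin θ ≤ ‖wedgePoint θ r‖ := by
  simpa [wedgePoint] using (sin_mul_le_norm_add_mul_ray (x := 1) hθ.sin_pos.le zero_le_one hr).1

theorem sin_mul_le_norm_wedgePoint {θ r : ℝ} (hθ : IsWedgeAngle θ) (hr : 0 ≤ r) :
    Real.sin θ * r ≤ ‖wedgePoint θ r‖ := by
  simpa [wedgePoint] using (sin_mul_le_norm_add_mul_ray (x := 1) hθ.sin_pos.le zero_le_one hr).2

theorem norm_wedgePoint_le {θ r : ℝ} (hr : 0 ≤ r) : ‖wedgePoint θ r‖ ≤ 1 + r := by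
  simpa [wedgePoint] using norm_add_mul_ray_le (θ := θ) (x := 1) zero_le_one hr

theorem norm_exp_wedgePoint (θ t r : ℝ) :
    ‖Complex.exp (t * wedgePoint θ r)‖ = Real.exp (t * (1 + r * Real.cos θ)) := by
  rw [Complex.norm_exp, Complex.re_ofReal_mul, wedgePoint_re]

theorem hasDerivAt_wedgePoint (θ r : ℝ) : HasDerivAt (wedgePoint θ) (ray θ) r := by
  unfold wedgePoint
  simpa using ((Complex.ofRealCLM.hasDerivAt (x := r)).mul_const (ray θ)).const_add 1

/-- The ray keeps distance at least sin θ from the origin and cos θ < 0, so no power of |s| can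
spoil the exponential decay. -/
theorem integrableOn_wedge_weight {θ t : ℝ} (hθ : IsWedgeAngle θ) (ht : 0 < t) (c : ℝ) :
    IntegrableOn (fun r => Real.exp (t * (1 + r * Real.cos θ)) * ‖wedgePoint θ r‖ ^ c) (Ioi 0) := by
  set ε := -t * Real.cos θ / 2 with hε
  have hε0 : 0 < ε := by have := hθ.cos_neg; rw [hε]; nlinarith
  obtain ⟨C, hC0, hC⟩ : ∃ C : ℝ, 0 ≤ C ∧ ∀ r : ℝ, 0 < r →
      ‖wedgePoint θ r‖ ^ c ≤ C * Real.exp (ε * r) := by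
    rcases le_total 0 c with hc | hc
    · obtain ⟨C, hC0, hC⟩ := exists_rpow_le_mul_exp hc hε0
      refine ⟨C * Real.exp ε, by positivity, fun r hr => (hC _ (norm_nonneg _)).trans ?_⟩
      rw [mul_assoc, ← Real.exp_add]
      gcongr
      nlinarith [norm_wedgePoint_le (θ := θ) hr.le]
    · refine ⟨Real.sin θ ^ c, (Real.rpow_pos_of_pos hθ.sin_pos _).le, fun r hr => ?_⟩
      have h1 := Real.rpow_le_rpow_of_nonpos hθ.sin_pos (sin_le_norm_wedgePoint hθ hr.le) hc
      have h2 : 1 ≤ Real.exp (ε * r) := Real.one_le_exp (by positivity)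
      have h3 := Real.rpow_pos_of_pos hθ.sin_pos c
      nlinarith
  have hcont := (continuous_wedgePoint θ).measurable
  refine Integrable.mono' ((integrableOn_rpow_mul_exp_neg (p := 0) (by norm_num) hε0).const_mul
    (C * Real.exp t)) (by fun_prop) ?_
  filter_upwards [self_mem_ae_restrict measurableSet_Ioi] with r hr
  have hr : 0 < r := hr
  rw [Real.norm_of_nonneg (by positivity), Real.rpow_zero, one_mul]
  calc _ ≤ Real.exp (t * (1 + r * Real.cos θ)) * (C * Real.exp (ε * r)) := by
        gcongr; exact hC r hr
    _ = C * Real.exp t * Real.exp (-(ε * r)) := by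
        rw [show Real.exp (t * (1 + r * Real.cos θ)) * (C * Real.exp (ε * r)) =
          C * (Real.exp (t * (1 + r * Real.cos θ)) * Real.exp (ε * r)) by ring, mul_assoc,
          ← Real.exp_add, ← Real.exp_add]
        congr 2
        rw [hε]
        ring

/-- The integrand of Hankel's integral for `1 / Γ` on the ray of angle `θ` from `1`. -/
def hankelIntegrand (θ ν t r : ℝ) : ℂ :=
  Complex.exp (t * wedgePoint θ r) * wedgePoint θ r ^ ((-ν : ℝ) : ℂ) * ray θ

theorem norm_hankelIntegrand (θ ν t r : ℝ) : ‖hankelIntegrand θ ν t r‖ =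
    Real.exp (t * (1 + r * Real.cos θ)) * ‖wedgePoint θ r‖ ^ (-ν) := by
  rw [hankelIntegrand, norm_mul, norm_mul, norm_ray, mul_one, norm_exp_wedgePoint,
    Complex.norm_cpow_real]

theorem measurable_hankelIntegrand (θ ν t : ℝ) : Measurable (hankelIntegrand θ ν t) := by
  have := (continuous_wedgePoint θ).measurable
  unfold hankelIntegrand
  fun_prop

theorem integrableOn_hankelIntegrand {θ t : ℝ} (hθ : IsWedgeAngle θ) (ht : 0 < t) (ν : ℝ) :
    IntegrableOn (hankelIntegrand θ ν t) (Ioi 0) := by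
  refine Integrable.mono' (integrableOn_wedge_weight hθ ht (-ν))
    (measurable_hankelIntegrand θ ν t).aestronglyMeasurable (Eventually.of_forall fun r => ?_)
  rw [norm_hankelIntegrand]

/-- Hankel's integral. -/
def hankel (θ ν t : ℝ) : ℝ := Real.pi⁻¹ * (∫ r in Ioi (0 : ℝ), hankelIntegrand θ ν t r).im

/-- Integration of the derivative of e^(ts) s^(-ν) along the ray. The boundary value at s = 1 is
e^t, which is real and drops out of the imaginary part. -/
theorem hankel_recurrence {θ t : ℝ} (hθ : IsWedgeAngle θ) (ht : 0 < t) (ν : ℝ) :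
    t * hankel θ ν t = ν * hankel θ (ν + 1) t := by
  have hder : ∀ r ∈ Ici (0 : ℝ), HasDerivAt
      (fun r => Complex.exp (t * wedgePoint θ r) * wedgePoint θ r ^ ((-ν : ℝ) : ℂ))
      (t * hankelIntegrand θ ν t r - ν * hankelIntegrand θ (ν + 1) t r) r := by
    intro r hr
    have h1 := ((hasDerivAt_wedgePoint θ r).const_mul (t : ℂ)).cexp
    have h2 := ((hasDerivAt_id (wedgePoint θ r)).cpow_const (c := ((-ν : ℝ) : ℂ))
      (wedgePoint_mem_slitPlane hθ hr)).comp r (hasDerivAt_wedgePoint θ r)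
    convert! h1.mul h2 using 1
    simp only [Function.comp, id, mul_one]
    rw [hankelIntegrand, hankelIntegrand, show ((-(ν + 1) : ℝ) : ℂ) = ((-ν : ℝ) : ℂ) - 1 by
      push_cast; ring]
    push_cast
    ring
  have i1 := integrableOn_hankelIntegrand hθ ht ν
  have i2 := integrableOn_hankelIntegrand hθ ht (ν + 1)
  have i3 : IntegrableOn
      (fun r => Complex.exp (t * wedgePoint θ r) * wedgePoint θ r ^ ((-ν : ℝ) : ℂ)) (Ioi 0) := by
    refine (i1.mul_const (ray θ)⁻¹).congr (Eventually.of_forall fun r => ?_)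
    simp only [hankelIntegrand]
    rw [mul_inv_cancel_right₀ (ray_ne_zero θ)]
  have i4 := (i1.const_mul (t : ℂ)).sub (i2.const_mul (ν : ℂ))
  have h0 := tendsto_zero_of_hasDerivAt_of_integrableOn_Ioi
    (fun r hr => hder r (Ioi_subset_Ici_self hr)) i4 i3
  have key := integral_Ioi_of_hasDerivAt_of_tendsto' hder i4 h0
  rw [integral_sub (i1.const_mul (t : ℂ)) (i2.const_mul (ν : ℂ)), integral_const_mul,
    integral_const_mul] at key
  have key2 := congrArg Complex.im key
  have hw : wedgePoint θ 0 = 1 := by simp [wedgePoint]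
  rw [hw, Complex.one_cpow, mul_one, mul_one, ← Complex.ofReal_exp, Complex.sub_im,
    Complex.im_ofReal_mul, Complex.im_ofReal_mul, Complex.sub_im, Complex.zero_im,
    Complex.ofReal_im] at key2
  rw [hankel, hankel]
  linear_combination Real.pi⁻¹ * key2

/-- The contour identity at y = 0, where the value a = 1/2 plays no role, leaves sin(πν) Γ(1-ν)
t^(ν-1)/π; the reflection formula finishes. -/
theorem hankel_of_lt_one {θ t ν : ℝ} (hθ : IsWedgeAngle θ) (ht : 0 < t) (hν : ν < 1) :
    hankel θ ν t = rlPower ν t := by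
  have h := (phiIntegrand_contour (b := ν) (κ := 0) (a := 1 / 2) (y := 0) (Or.inl rfl) (by simp)
    (by simpa using hν) (by norm_num) (by norm_num) ht le_rfl hθ.gt hθ.lt).2.2
  have e1 : ∀ r : ℝ, contourFun ν 0 (1 / 2) t 0 (1 + r * ray θ) * ray θ = hankelIntegrand θ ν t r := by
    intro r; simp [contourFun, hankelIntegrand, wedgePoint]
  simp only [e1] at h
  have e2 : ∫ r in Ioi (0 : ℝ), phiIntegrand (1 / 2) ν t 0 r =
      Real.sin (Real.pi * ν) * ((1 / t) ^ (1 - ν) * Real.Gamma (1 - ν)) := by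
    rw [← Real.integral_rpow_mul_exp_neg_mul_Ioi (by linarith) ht, ← integral_const_mul]
    refine setIntegral_congr_fun measurableSet_Ioi fun r hr => ?_
    have hr : (0 : ℝ) < r := hr
    simp only [phiIntegrand]
    rw [show 1 - ν - 1 = -ν by ring, Real.rpow_neg hr.le, Real.exp_neg]
    simp only [zero_mul, add_zero, zero_add]
    rw [mul_comm r t]
    field_simp
  rw [hankel, h, e2, rlPower]
  have hG := Real.Gamma_pos_of_pos (by linarith : 0 < 1 - ν)
  have hrefl := Real.Gamma_mul_Gamma_one_sub ν
  have e3 : (1 / t) ^ (1 - ν) = t ^ (ν - 1) := by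
    rw [one_div, Real.inv_rpow ht.le, ← Real.rpow_neg ht.le]; congr 1; ring
  rw [e3]
  -- Here ν is a pole of Γ, where `Real.Gamma` has the default value 0, so `rlPower` is 0 by
  -- division by zero, which is the correct value of 1/Γ.
  by_cases hs : Real.sin (Real.pi * ν) = 0
  · rw [hs, div_zero] at hrefl
    have : Real.Gamma ν = 0 := (mul_eq_zero.1 hrefl).resolve_right hG.ne'
    rw [this, hs]; simp
  · have hG2 : Real.Gamma ν ≠ 0 := by
      intro h0
      rw [h0, zero_mul] at hrefl
      exact (div_ne_zero Real.pi_ne_zero hs) hrefl.symm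
    rw [eq_div_iff hs] at hrefl
    rw [eq_div_iff hG2]
    have := Real.pi_ne_zero
    field_simp
    linear_combination hrefl

/-- For ν = 1 the integrand is not integrable at the origin, so the contour cannot be moved there;
continuity in ν from the left replaces the deformation. -/
theorem hankel_one {θ t : ℝ} (hθ : IsWedgeAngle θ) (ht : 0 < t) :
    hankel θ 1 t = rlPower 1 t := by
  have hmem : ∀ᶠ ν in 𝓝[<] (1 : ℝ), ν ∈ Ioo (0 : ℝ) 1 := Ioo_mem_nhdsLT one_pos
  have h1 : Tendsto (fun ν => hankel θ ν t) (𝓝[<] 1) (𝓝 (hankel θ 1 t)) := by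
    apply Tendsto.const_mul
    apply (Complex.continuous_im.tendsto _).comp
    refine tendsto_integral_filter_of_dominated_convergence
      (fun r => (Real.sin θ)⁻¹ * (Real.exp (t * (1 + r * Real.cos θ)) * ‖wedgePoint θ r‖ ^ (0 : ℝ)))
      (Eventually.of_forall fun ν => (measurable_hankelIntegrand θ ν t).aestronglyMeasurable)
      ?_ ((integrableOn_wedge_weight hθ ht 0).const_mul _) ?_
    · filter_upwards [hmem] with ν hν
      filter_upwards [self_mem_ae_restrict measurableSet_Ioi] with r hr
      rw [norm_hankelIntegrand, Real.rpow_zero, mul_one, mul_comm]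
      gcongr
      calc ‖wedgePoint θ r‖ ^ (-ν) ≤ Real.sin θ ^ (-ν) :=
            Real.rpow_le_rpow_of_nonpos hθ.sin_pos (sin_le_norm_wedgePoint hθ (le_of_lt hr))
              (by linarith [hν.1])
        _ ≤ Real.sin θ ^ (-1 : ℝ) :=
            Real.rpow_le_rpow_of_exponent_ge hθ.sin_pos (Real.sin_le_one θ) (by linarith [hν.2])
        _ = _ := Real.rpow_neg_one _
    · filter_upwards [self_mem_ae_restrict measurableSet_Ioi] with r hr
      have h2 : ContinuousAt (fun ν : ℝ => hankelIntegrand θ ν t r) 1 := by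
        unfold hankelIntegrand
        refine (ContinuousAt.mul continuousAt_const ?_).mul continuousAt_const
        exact ContinuousAt.comp (f := fun ν : ℝ => ((-ν : ℝ) : ℂ))
          (continuousAt_const_cpow (wedgePoint_ne_zero hθ (le_of_lt hr))) (by fun_prop)
      exact h2.tendsto.mono_left nhdsWithin_le_nhds
  have h2 : Tendsto (fun ν => rlPower ν t) (𝓝[<] 1) (𝓝 (rlPower 1 t)) := by
    have : ContinuousAt (fun ν => rlPower ν t) 1 := by
      unfold rlPower
      refine ContinuousAt.div ?_ (Real.hasDerivAt_Gamma_one.continuousAt) (by simp)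
      exact ContinuousAt.rpow continuousAt_const (by fun_prop) (Or.inl ht.ne')
    exact this.tendsto.mono_left nhdsWithin_le_nhds
  refine tendsto_nhds_unique h1 (h2.congr' ?_)
  filter_upwards [hmem] with ν hν
  exact (hankel_of_lt_one hθ ht hν.2).symm

/-- The recurrence carries the identity from ν ≤ 1 upwards one unit at a time. -/
theorem hankel_eq {θ t : ℝ} (hθ : IsWedgeAngle θ) (ht : 0 < t) (ν : ℝ) :
    hankel θ ν t = rlPower ν t := by
  have h : ∀ (n : ℕ) (ν : ℝ), ν ≤ n + 1 → hankel θ ν t = rlPower ν t := by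
    intro n
    induction n with
    | zero =>
      intro ν hν
      rcases (show ν ≤ 1 by simpa using hν).eq_or_lt with rfl | h
      · exact hankel_one hθ ht
      · exact hankel_of_lt_one hθ ht h
    | succ n ih =>
      intro ν hν
      push_cast at hν
      rcases le_or_gt ν 1 with h | h
      · exact ih ν (by have : (0 : ℝ) ≤ n := by positivity
                       linarith)
      · have h1 := hankel_recurrence hθ ht (ν - 1)
        rw [sub_add_cancel, ih (ν - 1) (by linarith)] at h1
        have h2 : ν - 1 ≠ 0 := by linarith
        have h3 : Real.Gamma ν = (ν - 1) * Real.Gamma (ν - 1) := by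
          rw [← Real.Gamma_add_one h2, sub_add_cancel]
        have h4 := (Real.Gamma_pos_of_pos (by linarith : 0 < ν - 1)).ne'
        have h5 : t * rlPower (ν - 1) t = (ν - 1) * rlPower ν t := by
          rw [rlPower, rlPower, h3, Real.rpow_sub_one ht.ne' (ν - 1)]
          field_simp
        exact mul_left_cancel₀ h2 (h1.symm.trans h5)
  obtain ⟨n, hn⟩ := exists_nat_ge ν
  exact h n ν (by linarith)

/-! ### The kernel as a contour integral, and its decay -/

/-- The integrand of the contour integral for `Φ_{a,b}(t,y)` on the ray of angle `θ` from `1`. -/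
def wedgeIntegrand (θ a b t y r : ℝ) : ℂ :=
  hankelIntegrand θ b t r * Complex.exp (-(y * wedgePoint θ r ^ (a : ℂ)))

/-- The contour integral for `Φ_{a,b}(t,y)`. -/
def wedgeKernel (θ a b t y : ℝ) : ℝ :=
  Real.pi⁻¹ * (∫ r in Ioi (0 : ℝ), wedgeIntegrand θ a b t y r).im

theorem integrableOn_phiIntegrand {a b t y : ℝ} (ha : 0 < a) (ha1 : a < 1) (hb : b ≤ 1)
    (ht : 0 < t) (hy : 0 ≤ y) : IntegrableOn (phiIntegrand a b t y) (Ioi 0) := by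
  have h1 : Real.pi / 2 < 3 * Real.pi / 4 := by linarith [Real.pi_pos]
  have h2 : 3 * Real.pi / 4 < Real.pi := by linarith [Real.pi_pos]
  rcases hb.eq_or_lt with rfl | hb
  · exact (phiIntegrand_contour (κ := 1) (Or.inr rfl) (by simp) (by linarith) ha ha1 ht hy h1 h2).1
  · exact (phiIntegrand_contour (κ := 0) (Or.inl rfl) (by simp) (by linarith) ha ha1 ht hy h1 h2).1

/-- For b = 1 the integrand is the subtracted one (κ = 1) plus Hankel's integrand of order 1, whose
contribution 1 is the Kronecker symbol. -/
theorem phiFormula_eq_wedgeKernel {θ a b t y : ℝ} (hθ : IsWedgeAngle θ) (ha : 0 < a) (ha1 : a < 1)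
    (hb : b ≤ 1) (ht : 0 < t) (hy : 0 ≤ y) : phiFormula a b t y = wedgeKernel θ a b t y := by
  rcases hb.eq_or_lt with rfl | hb
  · obtain ⟨-, h1, h2⟩ := phiIntegrand_contour (b := 1) (κ := 1) (Or.inr rfl) (by simp)
      (by linarith) ha ha1 ht hy hθ.gt hθ.lt
    have e1 : ∀ r : ℝ, wedgeIntegrand θ a 1 t y r =
        contourFun 1 1 a t y (1 + r * ray θ) * ray θ + hankelIntegrand θ 1 t r := by
      intro r
      simp only [contourFun, wedgeIntegrand, hankelIntegrand, wedgePoint]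
      push_cast
      ring
    have h3 := hankel_one hθ ht
    rw [hankel, rlPower] at h3
    simp only [sub_self, Real.rpow_zero, Real.Gamma_one, div_one] at h3
    rw [phiFormula, wedgeKernel, if_pos rfl, ← h2]
    simp only [e1]
    rw [integral_add h1 (integrableOn_hankelIntegrand hθ ht 1), Complex.add_im, mul_add, h3]
  · obtain ⟨-, h1, h2⟩ := phiIntegrand_contour (b := b) (κ := 0) (Or.inl rfl) (by simp)
      (by linarith) ha ha1 ht hy hθ.gt hθ.lt
    rw [phiFormula, wedgeKernel, if_neg hb.ne, ← h2, add_zero]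
    congr 3
    ext r
    simp only [contourFun, wedgeIntegrand, hankelIntegrand, wedgePoint]
    push_cast
    ring

/-- Because a < 1, there is room between π/2 and min(π, π/(2a)). Below π/(2a), s^a stays in the
right half-plane along the ray. -/
theorem exists_isWedgeAngle {a : ℝ} (ha : 0 < a) (ha1 : a < 1) :
    ∃ θ, IsWedgeAngle θ ∧ a * θ < Real.pi / 2 := by
  have hπ := Real.pi_pos
  have h1 : Real.pi / 2 < min Real.pi (Real.pi / 2 / a) := by
    apply lt_min (by linarith)
    rw [lt_div_iff₀ ha]
    nlinarith
  obtain ⟨θ, h2, h3⟩ := exists_between h1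
  refine ⟨θ, ⟨h2, h3.trans_le (min_le_left _ _)⟩, ?_⟩
  have h4 := h3.trans_le (min_le_right _ _)
  rw [lt_div_iff₀ ha] at h4
  linarith

/-- An argument beyond θ would make Im(s e^(-iθ)) positive, whereas it equals -sin θ all along the
ray. -/
theorem arg_wedgePoint_mem {θ r : ℝ} (hθ : IsWedgeAngle θ) (hr : 0 ≤ r) :
    0 ≤ (wedgePoint θ r).arg ∧ (wedgePoint θ r).arg ≤ θ := by
  have him : (wedgePoint θ r).im = r * Real.sin θ := by simp [wedgePoint, ray_im]
  have h0 : 0 ≤ (wedgePoint θ r).arg := by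
    rw [Complex.arg_nonneg_iff, him]
    exact mul_nonneg hr hθ.sin_pos.le
  refine ⟨h0, ?_⟩
  by_contra! hlt
  have h1 : 0 < Real.sin ((wedgePoint θ r).arg - θ) :=
    Real.sin_pos_of_pos_of_lt_pi (by linarith) (by linarith [Complex.arg_le_pi (wedgePoint θ r),
      hθ.pos])
  have hn := norm_pos_iff.2 (wedgePoint_ne_zero hθ hr)
  have h2 : ‖wedgePoint θ r‖ * Real.sin ((wedgePoint θ r).arg - θ) = -Real.sin θ := by
    rw [Real.sin_sub, mul_sub, ← mul_assoc, ← mul_assoc, Complex.norm_mul_sin_arg,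
      Complex.norm_mul_cos_arg, him, wedgePoint_re]
    ring
  have := mul_pos hn h1
  linarith [hθ.sin_pos]

theorem norm_rpow_mul_cos_le_re {θ a r : ℝ} (hθ : IsWedgeAngle θ) (ha : 0 < a)
    (haθ : a * θ < Real.pi / 2) (hr : 0 ≤ r) :
    ‖wedgePoint θ r‖ ^ a * Real.cos (a * θ) ≤ (wedgePoint θ r ^ (a : ℂ)).re := by
  obtain ⟨h1, h2⟩ := arg_wedgePoint_mem hθ hr
  rw [Complex.cpow_ofReal_re]
  have hn := norm_pos_iff.2 (wedgePoint_ne_zero hθ hr)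
  gcongr
  rw [mul_comm _ a]
  exact Real.cos_le_cos_of_nonneg_of_le_pi (by positivity) (by linarith [Real.pi_pos])
    (by gcongr)

/-- The rate of exponential decay in `y` of `wedgeKernel θ a b t y`. -/
def wedgeRate (θ a : ℝ) : ℝ := Real.sin θ ^ a * Real.cos (a * θ)

theorem cos_mul_pos {θ a : ℝ} (hθ : IsWedgeAngle θ) (ha : 0 < a) (haθ : a * θ < Real.pi / 2) :
    0 < Real.cos (a * θ) :=
  Real.cos_pos_of_mem_Ioo ⟨by have := mul_pos ha hθ.pos; linarith [Real.pi_pos], haθ⟩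

theorem wedgeRate_pos {θ a : ℝ} (hθ : IsWedgeAngle θ) (ha : 0 < a) (haθ : a * θ < Real.pi / 2) :
    0 < wedgeRate θ a :=
  mul_pos (Real.rpow_pos_of_pos hθ.sin_pos _) (cos_mul_pos hθ ha haθ)

theorem wedgeRate_le {θ a r : ℝ} (hθ : IsWedgeAngle θ) (ha : 0 < a) (haθ : a * θ < Real.pi / 2)
    (hr : 0 ≤ r) : wedgeRate θ a ≤ ‖wedgePoint θ r‖ ^ a * Real.cos (a * θ) := by
  have := cos_mul_pos hθ ha haθ
  have := hθ.sin_pos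
  unfold wedgeRate
  gcongr
  exact sin_le_norm_wedgePoint hθ hr

theorem norm_wedgeIntegrand_le {θ a y r : ℝ} (hθ : IsWedgeAngle θ) (ha : 0 < a)
    (haθ : a * θ < Real.pi / 2) (b t : ℝ) (hy : 0 ≤ y) (hr : 0 ≤ r) :
    ‖wedgeIntegrand θ a b t y r‖ ≤ Real.exp (t * (1 + r * Real.cos θ)) *
      ‖wedgePoint θ r‖ ^ (-b) * Real.exp (-(y * (‖wedgePoint θ r‖ ^ a * Real.cos (a * θ)))) := by
  rw [wedgeIntegrand, norm_mul, norm_hankelIntegrand, Complex.norm_exp, Complex.neg_re,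
    Complex.re_ofReal_mul]
  gcongr
  exact norm_rpow_mul_cos_le_re hθ ha haθ hr

theorem norm_wedgeIntegrand_le_exp {θ a y r : ℝ} (hθ : IsWedgeAngle θ) (ha : 0 < a)
    (haθ : a * θ < Real.pi / 2) (b t : ℝ) (hy : 0 ≤ y) (hr : 0 ≤ r) :
    ‖wedgeIntegrand θ a b t y r‖ ≤ Real.exp (t * (1 + r * Real.cos θ)) *
      ‖wedgePoint θ r‖ ^ (-b) * Real.exp (-(wedgeRate θ a * y)) := by
  refine (norm_wedgeIntegrand_le hθ ha haθ b t hy hr).trans ?_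
  rw [mul_comm (wedgeRate θ a)]
  gcongr
  exact wedgeRate_le hθ ha haθ hr

theorem measurable_wedgeIntegrand (θ a b : ℝ) :
    Measurable fun z : (ℝ × ℝ) × ℝ => wedgeIntegrand θ a b z.1.1 z.1.2 z.2 := by
  have := (continuous_wedgePoint θ).measurable
  unfold wedgeIntegrand hankelIntegrand
  fun_prop

theorem measurable_wedgeKernel (θ a b : ℝ) :
    Measurable fun z : ℝ × ℝ => wedgeKernel θ a b z.1 z.2 := by
  have h := (measurable_wedgeIntegrand θ a b).stronglyMeasurable.integral_prod_right'
    (ν := volume.restrict (Ioi (0 : ℝ)))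
  unfold wedgeKernel
  exact (Complex.measurable_im.comp h.measurable).const_mul _

theorem exists_abs_wedgeKernel_le {θ a t : ℝ} (hθ : IsWedgeAngle θ) (ha : 0 < a)
    (haθ : a * θ < Real.pi / 2) (ht : 0 < t) (b : ℝ) :
    ∃ C : ℝ, ∀ y : ℝ, 0 ≤ y → |wedgeKernel θ a b t y| ≤ C * Real.exp (-(wedgeRate θ a * y)) := by
  have hi := integrableOn_wedge_weight hθ ht (-b)
  refine ⟨Real.pi⁻¹ * ∫ r in Ioi (0 : ℝ), Real.exp (t * (1 + r * Real.cos θ)) *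
    ‖wedgePoint θ r‖ ^ (-b), fun y hy => ?_⟩
  rw [wedgeKernel, abs_mul, abs_of_pos (inv_pos.2 Real.pi_pos), mul_assoc, ← integral_mul_const]
  have := Real.pi_pos
  gcongr
  refine (Complex.abs_im_le_norm _).trans (norm_integral_le_of_norm_le (hi.mul_const _) ?_)
  filter_upwards [self_mem_ae_restrict measurableSet_Ioi] with r hr
  exact norm_wedgeIntegrand_le_exp hθ ha haθ b t hy (le_of_lt hr)

/-! ### Moments of the kernel -/

theorem integrableOn_pow_mul_cexp {z : ℂ} (hz : 0 < z.re) (k : ℕ) :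
    IntegrableOn (fun y : ℝ => (y : ℂ) ^ k * Complex.exp (-(y * z))) (Ioi 0) := by
  refine Integrable.mono' (integrableOn_rpow_mul_exp_neg (p := k) (by
    have : (0 : ℝ) ≤ k := by positivity
    linarith) hz) (by fun_prop) ?_
  filter_upwards [self_mem_ae_restrict measurableSet_Ioi] with y hy
  rw [norm_mul, norm_pow, Complex.norm_real, Real.norm_of_nonneg (le_of_lt hy), Complex.norm_exp,
    Complex.neg_re, Complex.re_ofReal_mul, Real.rpow_natCast, mul_comm y]

theorem integral_pow_mul_cexp {z : ℂ} (hz : 0 < z.re) (k : ℕ) :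
    ∫ y in Ioi (0 : ℝ), (y : ℂ) ^ k * Complex.exp (-(y * z)) = k.factorial / z ^ (k + 1) := by
  have hz0 : z ≠ 0 := fun h => by simp [h] at hz
  have hexp : ∀ y : ℝ, HasDerivAt (fun y : ℝ => Complex.exp (-(y * z)))
      (-(Complex.exp (-(y * z)) * z)) y := fun y => by
    simpa using (((Complex.ofRealCLM.hasDerivAt (x := y)).mul_const z).neg).cexp
  induction k with
  | zero =>
    have i0 := integrableOn_pow_mul_cexp hz 0
    simp only [pow_zero, one_mul] at i0
    have i1 := (i0.mul_const z).neg
    have h0 := tendsto_zero_of_hasDerivAt_of_integrableOn_Ioi (fun y _ => hexp y) i1 i0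
    have key := integral_Ioi_of_hasDerivAt_of_tendsto' (fun y _ => hexp y) i1 h0
    rw [integral_neg, integral_mul_const] at key
    simp only [Complex.ofReal_zero, zero_mul, neg_zero, Complex.exp_zero] at key
    simp only [pow_zero, one_mul, Nat.factorial_zero, Nat.cast_one, zero_add, pow_one]
    rw [eq_div_iff hz0]
    linear_combination -key
  | succ k ih =>
    have hder : ∀ y ∈ Ici (0 : ℝ), HasDerivAt
        (fun y : ℝ => (y : ℂ) ^ (k + 1) * Complex.exp (-(y * z)))
        ((k + 1 : ℂ) * ((y : ℂ) ^ k * Complex.exp (-(y * z))) -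
          z * ((y : ℂ) ^ (k + 1) * Complex.exp (-(y * z)))) y := by
      intro y _
      have h1 := (Complex.ofRealCLM.hasDerivAt (x := y)).pow (k + 1)
      convert! h1.mul (hexp y) using 1
      simp only [Complex.ofRealCLM_apply, Pi.pow_apply, Nat.add_sub_cancel]
      push_cast
      ring
    have i0 := integrableOn_pow_mul_cexp hz k
    have i1 := integrableOn_pow_mul_cexp hz (k + 1)
    have i2 := (i0.const_mul (k + 1 : ℂ)).sub (i1.const_mul z)
    have h0 := tendsto_zero_of_hasDerivAt_of_integrableOn_Ioi
      (fun y hy => hder y (Ioi_subset_Ici_self hy)) i2 i1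
    have key := integral_Ioi_of_hasDerivAt_of_tendsto' hder i2 h0
    rw [integral_sub (i0.const_mul _) (i1.const_mul _), integral_const_mul, integral_const_mul,
      ih] at key
    simp only [Complex.ofReal_zero, ne_eq, Nat.add_eq_zero_iff, one_ne_zero, and_false,
      not_false_eq_true, zero_pow, zero_mul, sub_zero] at key
    rw [eq_div_iff (pow_ne_zero _ hz0), Nat.factorial_succ]
    have h2 : (k + 1 : ℂ) * (k.factorial / z ^ (k + 1)) * z ^ (k + 1) =
        (k + 1 : ℂ) * k.factorial := by
      field_simp
    push_cast
    rw [← h2, pow_succ z (k + 1)]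
    linear_combination -z ^ (k + 1) * key

/-- By Fubini the y-integral is done first: it replaces e^(-y s^a) by k!/s^(a(k+1)), and Hankel's
integral of order ak + a + b is left. -/
theorem integral_wedgeKernel_mul_pow {θ a t : ℝ} (hθ : IsWedgeAngle θ) (ha : 0 < a)
    (haθ : a * θ < Real.pi / 2) (ht : 0 < t) (b : ℝ) (k : ℕ) :
    ∫ y in Ioi (0 : ℝ), wedgeKernel θ a b t y * y ^ k =
      k.factorial * rlPower (a * k + (a + b)) t := by
  have hK : Integrable (Function.uncurry fun (y r : ℝ) => (y : ℂ) ^ k * wedgeIntegrand θ a b t y r)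
      ((volume.restrict (Ioi (0 : ℝ))).prod (volume.restrict (Ioi (0 : ℝ)))) := by
    have hi1 := integrableOn_rpow_mul_exp_neg (p := k) (by
      have : (0 : ℝ) ≤ k := by positivity
      linarith) (wedgeRate_pos hθ ha haθ)
    have hi2 := integrableOn_wedge_weight hθ ht (-b)
    refine Integrable.mono' (hi1.mul_prod hi2) ?_ ?_
    · apply Measurable.aestronglyMeasurable
      have h1 : Measurable fun z : ℝ × ℝ => wedgeIntegrand θ a b t z.1 z.2 :=
        (measurable_wedgeIntegrand θ a b).comp
          (f := fun z : ℝ × ℝ => (((t, z.1), z.2) : (ℝ × ℝ) × ℝ)) (by fun_prop)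
      exact (by fun_prop : Measurable fun z : ℝ × ℝ => (z.1 : ℂ) ^ k).mul h1
    · rw [Measure.prod_restrict]
      filter_upwards [self_mem_ae_restrict (measurableSet_Ioi.prod measurableSet_Ioi)] with z hz
      obtain ⟨y, r⟩ := z
      obtain ⟨hy, hr⟩ := hz
      have hy : 0 < y := hy
      have hr : 0 < r := hr
      simp only [Function.uncurry]
      rw [norm_mul, norm_pow, Complex.norm_real, Real.norm_of_nonneg hy.le, Real.rpow_natCast]
      calc _ ≤ y ^ k * (Real.exp (t * (1 + r * Real.cos θ)) *
            ‖wedgePoint θ r‖ ^ (-b) * Real.exp (-(wedgeRate θ a * y))) := by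
            gcongr
            exact norm_wedgeIntegrand_le_exp hθ ha haθ b t hy.le hr.le
        _ = _ := by ring
  have h1 : ∀ y : ℝ, wedgeKernel θ a b t y * y ^ k =
      Real.pi⁻¹ * (∫ r in Ioi (0 : ℝ), (y : ℂ) ^ k * wedgeIntegrand θ a b t y r).im := by
    intro y
    rw [integral_const_mul, ← Complex.ofReal_pow, Complex.im_ofReal_mul, wedgeKernel]
    ring
  have h2 := integral_im (𝕜 := ℂ) hK.integral_prod_left
  simp only [RCLike.im_to_complex, Function.uncurry] at h2
  simp only [h1]
  rw [integral_const_mul, h2, integral_integral_swap hK]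
  have h3 : ∀ r ∈ Ioi (0 : ℝ), ∫ y in Ioi (0 : ℝ), (y : ℂ) ^ k * wedgeIntegrand θ a b t y r =
      (k.factorial : ℝ) * hankelIntegrand θ (a * k + (a + b)) t r := by
    intro r hr
    have hr : 0 < r := hr
    have hs := wedgePoint_ne_zero hθ hr.le
    have hz : 0 < (wedgePoint θ r ^ (a : ℂ)).re :=
      (wedgeRate_pos hθ ha haθ).trans_le ((wedgeRate_le hθ ha haθ hr.le).trans
        (norm_rpow_mul_cos_le_re hθ ha haθ hr.le))
    have h4 : ∀ y : ℝ, (y : ℂ) ^ k * wedgeIntegrand θ a b t y r = hankelIntegrand θ b t r *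
        ((y : ℂ) ^ k * Complex.exp (-(y * wedgePoint θ r ^ (a : ℂ)))) := by
      intro y; rw [wedgeIntegrand]; ring
    simp only [h4]
    rw [integral_const_mul, integral_pow_mul_cexp hz, hankelIntegrand, hankelIntegrand,
      ← Complex.cpow_mul_nat, show ((-(a * k + (a + b)) : ℝ) : ℂ) =
        ((-b : ℝ) : ℂ) - (a : ℂ) * ((k + 1 : ℕ) : ℂ) by push_cast; ring, Complex.cpow_sub _ _ hs]
    push_cast
    ring
  rw [setIntegral_congr_fun measurableSet_Ioi h3, integral_const_mul, Complex.im_ofReal_mul,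
    ← hankel_eq hθ ht, hankel]
  ring

/-! ### Pairing with the Bessel function -/

theorem besselFactor_eq_tsum (lam : ℂ) (y : ℝ) : besselFactor lam y =
    ∑' k : ℕ, lam ^ k / (k.factorial : ℂ) * ((y ^ k / k.factorial : ℝ) : ℂ) := by
  rw [besselFactor, besselI0]
  congr 1; ext k
  have h : ((lam * y) ^ (1 / 2 : ℂ)) ^ 2 = lam * y := by
    simp
  rw [mul_div_cancel_left₀ _ (two_ne_zero' ℂ), pow_mul, h, mul_pow]
  push_cast
  field_simp

/-- From (εy)^k/k! ≤ e^(εy), with ε > 0 arbitrary: the Bessel factor grows more slowly than any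
prescribed exponential. -/
theorem norm_besselFactor_term_le (lam : ℂ) {y ε : ℝ} (hy : 0 ≤ y) (hε : 0 < ε) (k : ℕ) :
    ‖lam ^ k / (k.factorial : ℂ) * ((y ^ k / k.factorial : ℝ) : ℂ)‖ ≤
      Real.exp (ε * y) * ((‖lam‖ / ε) ^ k / k.factorial) := by
  rw [norm_mul, norm_pow_div_factorial, Complex.norm_real, Real.norm_of_nonneg (by positivity)]
  have h := Real.pow_div_factorial_le_exp (ε * y) (by positivity) k
  calc ‖lam‖ ^ k / k.factorial * (y ^ k / k.factorial)
      = ((ε * y) ^ k / k.factorial) * ((‖lam‖ / ε) ^ k / k.factorial) := by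
        rw [mul_pow, div_pow]; field_simp
    _ ≤ _ := by gcongr

theorem hasSum_besselFactor (lam : ℂ) {y : ℝ} (hy : 0 ≤ y) :
    HasSum (fun k : ℕ => lam ^ k / (k.factorial : ℂ) * ((y ^ k / k.factorial : ℝ) : ℂ))
      (besselFactor lam y) := by
  rw [besselFactor_eq_tsum]
  exact (Summable.of_norm_bounded ((Real.summable_pow_div_factorial (‖lam‖ / 1)).mul_left
    (Real.exp (1 * y))) (norm_besselFactor_term_le lam hy one_pos)).hasSum

theorem norm_besselFactor_le (lam : ℂ) {y ε : ℝ} (hy : 0 ≤ y) (hε : 0 < ε) :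
    ‖besselFactor lam y‖ ≤ Real.exp (‖lam‖ / ε) * Real.exp (ε * y) := by
  rw [besselFactor_eq_tsum]
  have h1 : HasSum (fun k : ℕ => Real.exp (ε * y) * ((‖lam‖ / ε) ^ k / k.factorial))
      (Real.exp (ε * y) * Real.exp (‖lam‖ / ε)) := by
    have := NormedSpace.expSeries_div_hasSum_exp (𝔸 := ℝ) (‖lam‖ / ε)
    rw [← Real.exp_eq_exp_ℝ] at this
    exact this.mul_left _
  rw [mul_comm]
  exact tsum_of_norm_bounded h1 (norm_besselFactor_term_le lam hy hε)

theorem measurable_besselFactor (lam : ℂ) : Measurable (besselFactor lam) := by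
  have h : besselFactor lam = fun y =>
      ∑' k : ℕ, lam ^ k / (k.factorial : ℂ) * ((y ^ k / k.factorial : ℝ) : ℂ) :=
    funext (besselFactor_eq_tsum lam)
  rw [h]
  exact Measurable.tsum fun k => by fun_prop

theorem besselFactor_eq_wrightSeries (lam : ℂ) (y : ℝ) :
    besselFactor lam y = wrightSeries 1 1 lam y := by
  rw [besselFactor_eq_tsum, wrightSeries]
  congr 1; ext k
  rw [rlPower, one_mul, add_sub_cancel_right, Real.rpow_natCast, Real.Gamma_nat_eq_factorial]

/-- The integral of an exponentially decaying function against `besselFactor`, in terms of its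
moments. -/
theorem hasSum_integral_mul_besselFactor (lam : ℂ) {g : ℝ → ℝ} {C δ : ℝ} {m : ℕ → ℝ}
    (hg : Measurable g) (hδ : 0 < δ) (hb : ∀ y, 0 < y → |g y| ≤ C * Real.exp (-(δ * y)))
    (hm : ∀ k : ℕ, ∫ y in Ioi (0 : ℝ), g y * y ^ k = k.factorial * m k) :
    IntegrableOn (fun y => (g y : ℂ) * besselFactor lam y) (Ioi 0) ∧
    HasSum (fun k : ℕ => lam ^ k / (k.factorial : ℂ) * (m k : ℂ))
      (∫ y in Ioi (0 : ℝ), (g y : ℂ) * besselFactor lam y) := by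
  -- Half of the decay rate δ is spent on the growth of the Bessel factor.
  have hexp : IntegrableOn (fun y : ℝ => C * Real.exp (-(δ / 2 * y))) (Ioi 0) := by
    simpa [IntegrableOn] using (integrableOn_rpow_mul_exp_neg (p := 0) (by norm_num) (half_pos hδ)).const_mul C
  have hC : ∀ y, 0 < y → ∀ z : ℂ, ∀ M : ℝ, ‖z‖ ≤ Real.exp (δ / 2 * y) * M →
      ‖(g y : ℂ) * z‖ ≤ C * Real.exp (-(δ / 2 * y)) * M := by
    intro y hy z M hz
    rw [norm_mul, Complex.norm_real, Real.norm_eq_abs]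
    calc |g y| * ‖z‖ ≤ C * Real.exp (-(δ * y)) * (Real.exp (δ / 2 * y) * M) := by
          have := (abs_nonneg _).trans (hb y hy)
          exact mul_le_mul (hb y hy) hz (norm_nonneg _) this
      _ = _ := by
          rw [show -(δ * y) = -(δ / 2 * y) + -(δ / 2 * y) by ring, Real.exp_add, Real.exp_neg]
          field_simp
  constructor
  · refine Integrable.mono' (hexp.mul_const (Real.exp (‖lam‖ / (δ / 2)))) ?_ ?_
    · have := measurable_besselFactor lam
      apply Measurable.aestronglyMeasurable
      fun_prop
    · filter_upwards [self_mem_ae_restrict measurableSet_Ioi] with y hy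
      refine hC y hy _ _ ?_
      rw [mul_comm]
      exact norm_besselFactor_le lam (le_of_lt hy) (half_pos hδ)
  · have hbs := Real.summable_pow_div_factorial (‖lam‖ / (δ / 2))
    have key := hasSum_integral_of_dominated_convergence (μ := volume.restrict (Ioi (0 : ℝ)))
      (F := fun (k : ℕ) y => (g y : ℂ) *
        (lam ^ k / (k.factorial : ℂ) * ((y ^ k / k.factorial : ℝ) : ℂ)))
      (f := fun y => (g y : ℂ) * besselFactor lam y)
      (fun k y => C * Real.exp (-(δ / 2 * y)) * ((‖lam‖ / (δ / 2)) ^ k / k.factorial))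
      (fun k => by apply Measurable.aestronglyMeasurable; fun_prop)
      (fun k => by
        filter_upwards [self_mem_ae_restrict measurableSet_Ioi] with y hy
        exact hC y hy _ _ (norm_besselFactor_term_le lam (le_of_lt hy) (half_pos hδ) k))
      (Eventually.of_forall fun y => hbs.mul_left _)
      (by simp_rw [tsum_mul_left]; exact hexp.mul_const _)
      (by
        filter_upwards [self_mem_ae_restrict measurableSet_Ioi] with y hy
        exact (hasSum_besselFactor lam (le_of_lt hy)).mul_left _)
    convert! key using 1
    ext k
    have h1 : ∀ y : ℝ, (g y : ℂ) * (lam ^ k / (k.factorial : ℂ) * ((y ^ k / k.factorial : ℝ) : ℂ)) =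
        lam ^ k / (k.factorial : ℂ) * ((((k.factorial : ℝ)⁻¹ * (g y * y ^ k) : ℝ)) : ℂ) := by
      intro y; push_cast; ring
    simp only [h1]
    rw [integral_const_mul, integral_complex_ofReal, integral_const_mul, hm,
      inv_mul_cancel_left₀ (by exact_mod_cast k.factorial_ne_zero)]

/-- The pairing of the contour integral with `besselFactor`. -/
theorem integral_wedgeKernel_mul_besselFactor {θ a b t : ℝ} (hθ : IsWedgeAngle θ) (ha : 0 < a)
    (haθ : a * θ < Real.pi / 2) (ht : 0 < t) (hab : 0 < a + b) (lam : ℂ) :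
    IntegrableOn (fun y => (wedgeKernel θ a b t y : ℂ) * besselFactor lam y) (Ioi 0) ∧
    ∫ y in Ioi (0 : ℝ), (wedgeKernel θ a b t y : ℂ) * besselFactor lam y =
      wrightSeries a (a + b) lam t := by
  obtain ⟨C, hC⟩ := exists_abs_wedgeKernel_le hθ ha haθ ht b
  have hmeas : Measurable (wedgeKernel θ a b t) :=
    (measurable_wedgeKernel θ a b).comp (f := fun y : ℝ => ((t, y) : ℝ × ℝ)) (by fun_prop)
  have h := hasSum_integral_mul_besselFactor (g := wedgeKernel θ a b t) (C := C)
    (δ := wedgeRate θ a) (m := fun k => rlPower (a * k + (a + b)) t) lam hmeas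
    (wedgeRate_pos hθ ha haθ) (fun y hy => hC y hy.le) (integral_wedgeKernel_mul_pow hθ ha haθ ht b)
  have h3 := hasSum_wrightSeries ha.le hab lam ht
  exact ⟨h.1, h.2.unique h3⟩

/-! ### The case b > 1 -/

theorem integrableOn_norm_wedgePoint_rpow {θ p : ℝ} (hθ : IsWedgeAngle θ) (hp : p < -1) :
    IntegrableOn (fun r => ‖wedgePoint θ r‖ ^ p) (Ioi 0) := by
  have h1 : Integrable (fun r : ℝ => (1 + ‖r‖) ^ (-(-p))) :=
    integrable_one_add_norm (by simpa using (by linarith : 1 < -p))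
  have hm := (continuous_wedgePoint θ).measurable
  have hs := hθ.sin_pos
  refine Integrable.mono' (h1.integrableOn.const_mul ((Real.sin θ / 2) ^ p))
    (hm.norm.pow_const p).aestronglyMeasurable ?_
  filter_upwards [self_mem_ae_restrict measurableSet_Ioi] with r hr
  have hr : 0 < r := hr
  rw [Real.norm_of_nonneg (by positivity), neg_neg, Real.norm_of_nonneg hr.le,
    ← Real.mul_rpow (by positivity) (by positivity)]
  refine Real.rpow_le_rpow_of_nonpos (by positivity) ?_ (by linarith)
  linarith [sin_le_norm_wedgePoint hθ hr.le, sin_mul_le_norm_wedgePoint hθ hr.le]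

theorem exp_neg_le_rpow {w : ℝ} (hw : 0 < w) : Real.exp (-w) ≤ w ^ (-(1 / 2) : ℝ) := by
  rw [Real.exp_neg, Real.rpow_neg hw.le]
  apply inv_anti₀ (Real.rpow_pos_of_pos hw _)
  rw [← Real.sqrt_eq_rpow]
  have h1 := Real.add_one_le_exp w
  have h2 := Real.sq_sqrt hw.le
  nlinarith [sq_nonneg (Real.sqrt w - 1)]

/-- A bound usable down to x = 0, where e^(xs) no longer decays and |s|^(-1) alone is not
integrable. Half of the exponent y |s|^a cos(aθ) is traded for y^(-1/2) |s|^(-a/2), which makes the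
integral along the ray converge; the other half keeps the decay in y. -/
theorem exists_abs_wedgeKernel_one_le {θ a : ℝ} (hθ : IsWedgeAngle θ) (ha : 0 < a)
    (haθ : a * θ < Real.pi / 2) : ∃ C : ℝ, 0 ≤ C ∧ ∀ x y : ℝ, 0 < x → 0 < y →
      |wedgeKernel θ a 1 x y| ≤
        C * Real.exp x * (y ^ (-(1 / 2) : ℝ) * Real.exp (-(wedgeRate θ a / 2 * y))) := by
  have hi := integrableOn_norm_wedgePoint_rpow hθ (by linarith : -1 - a / 2 < -1)
  have hc := cos_mul_pos hθ ha haθ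
  have hπ := Real.pi_pos
  have hI : 0 ≤ ∫ r in Ioi (0 : ℝ), ‖wedgePoint θ r‖ ^ (-1 - a / 2) :=
    integral_nonneg fun r => by positivity
  refine ⟨Real.pi⁻¹ * ((Real.cos (a * θ) / 2) ^ (-(1 / 2) : ℝ) *
    ∫ r in Ioi (0 : ℝ), ‖wedgePoint θ r‖ ^ (-1 - a / 2)), by positivity, fun x y hx hy => ?_⟩
  rw [wedgeKernel, abs_mul, abs_of_pos (inv_pos.2 hπ), mul_assoc, mul_assoc]
  gcongr
  refine (Complex.abs_im_le_norm _).trans ?_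
  have h1 : ‖∫ r in Ioi (0 : ℝ), wedgeIntegrand θ a 1 x y r‖ ≤ ∫ r in Ioi (0 : ℝ),
      ((Real.cos (a * θ) / 2) ^ (-(1 / 2) : ℝ) * (Real.exp x * (y ^ (-(1 / 2) : ℝ) *
        Real.exp (-(wedgeRate θ a / 2 * y))))) * ‖wedgePoint θ r‖ ^ (-1 - a / 2) := by
    refine norm_integral_le_of_norm_le (hi.const_mul _) ?_
    filter_upwards [self_mem_ae_restrict measurableSet_Ioi] with r hr
    have hr : 0 < r := hr
    refine (norm_wedgeIntegrand_le hθ ha haθ 1 x hy.le hr.le).trans ?_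
    set N := ‖wedgePoint θ r‖ with hN
    have hN0 : 0 < N := norm_pos_iff.2 (wedgePoint_ne_zero hθ hr.le)
    have hrate := wedgeRate_le hθ ha haθ hr.le
    have e1 : Real.exp (x * (1 + r * Real.cos θ)) ≤ Real.exp x := by
      apply Real.exp_le_exp.2
      nlinarith [hθ.cos_neg, mul_pos hx hr]
    have e2 : Real.exp (-(y * (N ^ a * Real.cos (a * θ)))) ≤
        Real.exp (-(wedgeRate θ a / 2 * y)) *
          (y ^ (-(1 / 2) : ℝ) * (N ^ (-(a / 2)) * (Real.cos (a * θ) / 2) ^ (-(1 / 2) : ℝ))) := by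
      have e3 : y ^ (-(1 / 2) : ℝ) * (N ^ (-(a / 2)) * (Real.cos (a * θ) / 2) ^ (-(1 / 2) : ℝ)) =
          (y * (N ^ a * (Real.cos (a * θ) / 2))) ^ (-(1 / 2) : ℝ) := by
        rw [Real.mul_rpow hy.le (by positivity), Real.mul_rpow (by positivity) (by positivity),
          ← Real.rpow_mul hN0.le]
        congr 3
        ring
      rw [e3]
      calc Real.exp (-(y * (N ^ a * Real.cos (a * θ))))
          = Real.exp (-(y * (N ^ a * (Real.cos (a * θ) / 2)))) *
            Real.exp (-(y * (N ^ a * (Real.cos (a * θ) / 2)))) := by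
            rw [← Real.exp_add]; congr 1; ring
        _ ≤ _ := by
            refine mul_le_mul (Real.exp_le_exp.2 ?_) (exp_neg_le_rpow (by positivity))
              (Real.exp_pos _).le (Real.exp_pos _).le
            nlinarith
    calc _ ≤ Real.exp x * N ^ (-1 : ℝ) * (Real.exp (-(wedgeRate θ a / 2 * y)) *
          (y ^ (-(1 / 2) : ℝ) * (N ^ (-(a / 2)) *
            (Real.cos (a * θ) / 2) ^ (-(1 / 2) : ℝ)))) := by gcongr
      _ = _ := by
          rw [show -1 - a / 2 = -1 + -(a / 2) by ring, Real.rpow_add hN0]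
          ring
  refine h1.trans (le_of_eq ?_)
  rw [integral_const_mul]
  ring

theorem rlPower_intervalIntegrable {t c : ℝ} (ht : 0 < t) (hc : 0 < c) :
    IntervalIntegrable (fun x => rlPower c (t - x)) volume 0 t := by
  simpa using rlKernel_intervalIntegrable ht hc one_pos

theorem intervalIntegrable_rpow_mul_phiFormula_one {a b t y : ℝ} (ha : 0 < a) (ha1 : a < 1)
    (hb : 1 < b) (ht : 0 < t) (hy : 0 < y) :
    IntervalIntegrable (fun x => (t - x) ^ (b - 2) * phiFormula a 1 x y) volume 0 t := by
  obtain ⟨θ, hθ, haθ⟩ := exists_isWedgeAngle ha ha1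
  obtain ⟨C, hC0, hC⟩ := exists_abs_wedgeKernel_one_le hθ ha haθ
  have h1 := (betaKernel_intervalIntegrable ht (by linarith : 0 < b - 1) one_pos)
  rw [intervalIntegrable_iff_integrableOn_Ioc_of_le ht.le] at h1 ⊢
  have h2 : IntegrableOn (fun x => (t - x) ^ (b - 2) * wedgeKernel θ a 1 x y) (Ioc 0 t) := by
    refine Integrable.mono' (h1.const_mul
      (C * Real.exp t * (y ^ (-(1 / 2) : ℝ) * Real.exp (-(wedgeRate θ a / 2 * y))))) ?_ ?_
    · have : Measurable fun x => wedgeKernel θ a 1 x y :=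
        (measurable_wedgeKernel θ a 1).comp (f := fun x : ℝ => ((x, y) : ℝ × ℝ)) (by fun_prop)
      apply Measurable.aestronglyMeasurable
      fun_prop
    · filter_upwards [self_mem_ae_restrict measurableSet_Ioc] with x hx
      have hx' : 0 ≤ t - x := by linarith [hx.2]
      rw [norm_mul, Real.norm_of_nonneg (by positivity), Real.norm_eq_abs, sub_self,
        Real.rpow_zero, mul_one, show b - 1 - 1 = b - 2 by ring, mul_comm]
      gcongr
      refine (hC x y hx.1 hy).trans ?_
      gcongr
      exact hx.2
  refine h2.congr_fun (fun x hx => ?_) measurableSet_Ioc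
  simp only
  rw [phiFormula_eq_wedgeKernel hθ ha ha1 le_rfl hx.1 hy.le]

theorem phiConverges {α b t y : ℝ} (hα : 0 < α) (hα1 : α ≤ 1) (ht : 0 < t) (hy : 0 < y) :
    PhiConverges α b t y := by
  refine ⟨fun h hb => integrableOn_phiIntegrand hα (lt_of_le_of_ne hα1 h) hb ht hy.le,
    fun h hb => ⟨fun x hx => integrableOn_phiIntegrand hα (lt_of_le_of_ne hα1 h) le_rfl hx hy.le,
      intervalIntegrable_rpow_mul_phiFormula_one hα (lt_of_le_of_ne hα1 h) hb ht hy⟩⟩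

theorem phi_pairing_of_le_one {a b t : ℝ} (ha : 0 < a) (ha1 : a < 1) (hb : b ≤ 1)
    (hab : 0 < a + b) (ht : 0 < t) (lam : ℂ) :
    IntegrableOn (fun y => (phi a b t y : ℂ) * besselFactor lam y) (Ioi 0) ∧
    ∫ y in Ioi (0 : ℝ), (phi a b t y : ℂ) * besselFactor lam y =
      wrightSeries a (a + b) lam t := by
  obtain ⟨θ, hθ, haθ⟩ := exists_isWedgeAngle ha ha1
  obtain ⟨h1, h2⟩ := integral_wedgeKernel_mul_besselFactor hθ ha haθ ht hab lam
  have h3 : ∀ y ∈ Ioi (0 : ℝ), (wedgeKernel θ a b t y : ℂ) * besselFactor lam y =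
      (phi a b t y : ℂ) * besselFactor lam y := fun y hy => by
    rw [phi, if_neg ha1.ne, if_pos hb, phiFormula_eq_wedgeKernel hθ ha ha1 hb ht (le_of_lt hy)]
  exact ⟨h1.congr_fun h3 measurableSet_Ioi, by
    rw [← h2, setIntegral_congr_fun measurableSet_Ioi h3]⟩

/-- Fubini moves the Riemann-Liouville integral outside the pairing; there it acts on the series for
b = 1 and raises a + 1 to a + b. -/
theorem phi_pairing_of_one_lt {a b t : ℝ} (ha : 0 < a) (ha1 : a < 1) (hb : 1 < b)
    (ht : 0 < t) (lam : ℂ) :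
    IntegrableOn (fun y => (phi a b t y : ℂ) * besselFactor lam y) (Ioi 0) ∧
    ∫ y in Ioi (0 : ℝ), (phi a b t y : ℂ) * besselFactor lam y =
      wrightSeries a (a + b) lam t := by
  obtain ⟨θ, hθ, haθ⟩ := exists_isWedgeAngle ha ha1
  obtain ⟨C, hC0, hC⟩ := exists_abs_wedgeKernel_one_le hθ ha haθ
  have hb1 : 0 < b - 1 := by linarith
  -- The kernel decays at half of `wedgeRate`; a quarter is granted to the Bessel factor and a
  -- quarter is left.
  have hδ : 0 < wedgeRate θ a / 4 := by have := wedgeRate_pos hθ ha haθ; positivity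
  have hK : Integrable (Function.uncurry fun (x y : ℝ) =>
      (rlPower (b - 1) (t - x) : ℂ) * ((wedgeKernel θ a 1 x y : ℂ) * besselFactor lam y))
      ((volume.restrict (Ioc 0 t)).prod (volume.restrict (Ioi (0 : ℝ)))) := by
    have hi1 := (rlPower_intervalIntegrable ht hb1).abs
    rw [intervalIntegrable_iff_integrableOn_Ioc_of_le ht.le] at hi1
    have hi2 := integrableOn_rpow_mul_exp_neg (p := -(1 / 2)) (by norm_num) hδ
    refine Integrable.mono' ((hi1.mul_prod hi2).const_mul
      (C * Real.exp t * Real.exp (‖lam‖ / (wedgeRate θ a / 4)))) ?_ ?_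
    · apply Measurable.aestronglyMeasurable
      have h1 := measurable_wedgeKernel θ a 1
      have h2 := measurable_besselFactor lam
      have h3 : Measurable fun z : ℝ × ℝ => rlPower (b - 1) (t - z.1) := by
        unfold rlPower; fun_prop
      exact (Complex.measurable_ofReal.comp h3).mul
        ((Complex.measurable_ofReal.comp h1).mul (h2.comp measurable_snd))
    · rw [Measure.prod_restrict]
      filter_upwards [self_mem_ae_restrict (measurableSet_Ioc.prod measurableSet_Ioi)] with z hz
      obtain ⟨x, y⟩ := z
      obtain ⟨⟨hx, hxt⟩, hy⟩ := hz
      simp only at hx hxt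
      have hy : 0 < y := hy
      simp only [Function.uncurry]
      rw [norm_mul, norm_mul, Complex.norm_real, Complex.norm_real, Real.norm_eq_abs,
        Real.norm_eq_abs]
      calc _ ≤ |rlPower (b - 1) (t - x)| * (C * Real.exp t * (y ^ (-(1 / 2) : ℝ) *
            Real.exp (-(wedgeRate θ a / 2 * y))) *
              (Real.exp (‖lam‖ / (wedgeRate θ a / 4)) * Real.exp (wedgeRate θ a / 4 * y))) := by
            gcongr
            · refine (hC x y hx hy).trans ?_
              gcongr
            · exact norm_besselFactor_le lam hy.le hδ
        _ = C * Real.exp t * Real.exp (‖lam‖ / (wedgeRate θ a / 4)) *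
            (|rlPower (b - 1) (t - x)| * (y ^ (-(1 / 2) : ℝ) *
              (Real.exp (-(wedgeRate θ a / 2 * y)) * Real.exp (wedgeRate θ a / 4 * y)))) := by
            ring
        _ = _ := by
            rw [← Real.exp_add,
              show -(wedgeRate θ a / 2 * y) + wedgeRate θ a / 4 * y = -(wedgeRate θ a / 4 * y) by
                ring]
  have h3 : ∀ y ∈ Ioi (0 : ℝ), ∫ x in Ioc 0 t,
      (rlPower (b - 1) (t - x) : ℂ) * ((wedgeKernel θ a 1 x y : ℂ) * besselFactor lam y) =
      (phi a b t y : ℂ) * besselFactor lam y := fun y hy => by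
    have h4 : ∀ x ∈ Ioc 0 t,
        (rlPower (b - 1) (t - x) : ℂ) * ((wedgeKernel θ a 1 x y : ℂ) * besselFactor lam y) =
        (((Real.Gamma (b - 1))⁻¹ * ((t - x) ^ (b - 2) * phiFormula a 1 x y) : ℝ) : ℂ) *
          besselFactor lam y := fun x hx => by
      rw [phiFormula_eq_wedgeKernel hθ ha ha1 le_rfl hx.1 (le_of_lt hy), rlPower,
        show b - 1 - 1 = b - 2 by ring]
      push_cast
      ring
    rw [setIntegral_congr_fun measurableSet_Ioc h4, integral_mul_const, integral_complex_ofReal,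
      integral_const_mul, ← intervalIntegral.integral_of_le ht.le, phi, if_neg ha1.ne,
      if_neg (not_le.2 hb)]
  refine ⟨IntegrableOn.congr_fun hK.integral_prod_right h3 measurableSet_Ioi, ?_⟩
  rw [← setIntegral_congr_fun measurableSet_Ioi h3, ← integral_integral_swap hK]
  have h5 : ∀ x ∈ Ioc 0 t, ∫ y in Ioi (0 : ℝ),
      (rlPower (b - 1) (t - x) : ℂ) * ((wedgeKernel θ a 1 x y : ℂ) * besselFactor lam y) =
      (rlPower (b - 1) (t - x) : ℂ) * wrightSeries a (a + 1) lam x := fun x hx => by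
    rw [integral_const_mul, (integral_wedgeKernel_mul_besselFactor hθ ha haθ hx.1
      (by linarith) lam).2]
  rw [setIntegral_congr_fun measurableSet_Ioc h5, ← intervalIntegral.integral_of_le ht.le,
    integral_rlKernel_mul_wrightSeries ha.le (by linarith) hb1 ht]
  congr 1
  ring

/-! ### The case a = 1 and the assembly -/

/-- The Bessel factor is itself the series with parameters 1, 1, and the kernel is the
Riemann-Liouville kernel of order b. -/
theorem phi_one_pairing {b t : ℝ} (hb : 0 < b) (ht : 0 < t) (lam : ℂ) :
    IntegrableOn (fun y => (phi 1 b t y : ℂ) * besselFactor lam y) (Ioi 0) ∧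
    ∫ y in Ioi (0 : ℝ), (phi 1 b t y : ℂ) * besselFactor lam y =
      wrightSeries 1 (1 + b) lam t := by
  have h1 : (fun y => (phi 1 b t y : ℂ) * besselFactor lam y) =
      (Iio t).indicator fun y => (rlPower b (t - y) : ℂ) * wrightSeries 1 1 lam y := by
    ext y
    by_cases hy : y < t
    · rw [indicator_of_mem (mem_Iio.2 hy), phi, if_pos rfl, if_pos hy, rlPower,
        besselFactor_eq_wrightSeries]
    · rw [indicator_of_notMem (by simpa using hy), phi, if_pos rfl, if_neg hy]
      simp
  have h2 := intervalIntegrable_mul_wrightSeries (a := 1) zero_le_one one_pos ht.le lam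
    (rlKernel_intervalIntegrable ht hb one_pos)
  have hset : Ioi (0 : ℝ) ∩ Iio t = Ioo 0 t := rfl
  have h3 := integral_rlKernel_mul_wrightSeries zero_le_one one_pos hb ht lam (a := 1)
  rw [intervalIntegrable_iff_integrableOn_Ioc_of_le ht.le] at h2
  rw [intervalIntegral.integral_of_le ht.le, integral_Ioc_eq_integral_Ioo] at h3
  rw [h1]
  constructor
  · rw [IntegrableOn, integrable_indicator_iff measurableSet_Iio, IntegrableOn,
      Measure.restrict_restrict measurableSet_Iio, inter_comm, hset]
    exact h2.mono_set Ioo_subset_Ioc_self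
  · rw [setIntegral_indicator measurableSet_Iio, hset, h3, add_comm]

theorem integrableOn_phi_mul_besselFactor {α b t : ℝ} (hα : 0 < α) (hα1 : α ≤ 1)
    (hαb : 0 < α + b) (hb1 : α = 1 → 0 ≤ b) (ht : 0 < t) (lam : ℂ) (h : ¬(α = 1 ∧ b = 0)) :
    IntegrableOn (fun y => (phi α b t y : ℂ) * besselFactor lam y) (Ioi 0) ∧
    ∫ y in Ioi (0 : ℝ), (phi α b t y : ℂ) * besselFactor lam y =
      wrightSeries α (α + b) lam t := by
  rcases hα1.eq_or_lt with rfl | hα1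
  · exact phi_one_pairing (lt_of_le_of_ne (hb1 rfl) fun h0 => h ⟨rfl, h0.symm⟩) ht lam
  · rcases le_or_gt b 1 with hb | hb
    · exact phi_pairing_of_le_one hα hα1 hb hαb ht lam
    · exact phi_pairing_of_one_lt hα hα1 hb ht lam

theorem phiPairing_besselFactor {α b t : ℝ} (hα : 0 < α) (hα1 : α ≤ 1)
    (hαb : 0 < α + b) (hb1 : α = 1 → 0 ≤ b) (ht : 0 < t) (lam : ℂ) :
    phiPairing α b t (besselFactor lam) = wrightSeries α (α + b) lam t := by
  rw [phiPairing]
  split_ifs with h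
  · obtain ⟨rfl, rfl⟩ := h
    rw [add_zero, besselFactor_eq_wrightSeries]
  · exact (integrableOn_phi_mul_besselFactor hα hα1 hαb hb1 ht lam h).2

theorem outerIntegrand_eq {α β : ℝ} (hα : 0 < α) (hα1 : α ≤ 1) (hαβ : 1 < α + β)
    (hβ1 : α = 1 → 1 ≤ β) (lam : ℂ) (t : ℝ) {x : ℝ} (hx : 0 < x) :
    outerIntegrand α β lam t x =
      (logKernel (t - x) : ℂ) * wrightSeries α (α + (β - 1)) lam x := by
  rw [outerIntegrand, logKernel, phiPairing_besselFactor hα hα1 (by linarith)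
    (fun h => by linarith [hβ1 h]) hx]

/-- Near α one has 0^a = 0 and only the term k = 0 survives, so the function is locally constant
whatever value 0^(β-1) takes. -/
theorem hasDerivAt_zero_rpow_mul_wright {α β : ℝ} (hα : 0 < α) (lam : ℂ) :
    HasDerivAt (fun a : ℝ =>
      (((0 : ℝ) ^ (β - 1) : ℝ) : ℂ) * wright a β (lam * (((0 : ℝ) ^ a : ℝ) : ℂ))) 0 α := by
  refine (hasDerivAt_const α ((((0 : ℝ) ^ (β - 1) : ℝ) : ℂ) * wright 0 β 0)).congr_of_eventuallyEq ?_
  filter_upwards [lt_mem_nhds hα] with a ha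
  rw [Real.zero_rpow ha.ne', Complex.ofReal_zero, mul_zero, wright, wright]
  congr 2; ext k
  rcases eq_or_ne k 0 with rfl | hk
  · simp
  · simp [hk]

end EfrosWright

end

theorem mainTheorem11 (α β : ℝ) (lam : ℂ) (t : ℝ)
    (hα : 0 < α) (hα1 : α ≤ 1) (hβ : 0 < β) (hαβ : 1 < α + β) (hβ1 : α = 1 → 1 ≤ β)
    (ht : 0 ≤ t) :
    (∀ t₁ t₂ : ℝ, 0 < t₁ → 0 < t₂ → EfrosWright.PhiConverges α (β - 1) t₁ t₂) ∧
    (∀ t₁ : ℝ, 0 < t₁ → ¬ (α = 1 ∧ β = 1) →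
      MeasureTheory.IntegrableOn
        (fun t₂ : ℝ =>
          (EfrosWright.phi α (β - 1) t₁ t₂ : ℂ) * EfrosWright.besselFactor lam t₂)
        (Set.Ioi 0)) ∧
    IntervalIntegrable (EfrosWright.outerIntegrand α β lam t) MeasureTheory.volume 0 t ∧
    HasDerivAt
      (fun a : ℝ =>
        ((t ^ (β - 1) : ℝ) : ℂ) * EfrosWright.wright a β (lam * ((t ^ a : ℝ) : ℂ)))
      (lam * ∫ t₁ in (0 : ℝ)..t, EfrosWright.outerIntegrand α β lam t t₁)
      α := by
  refine ⟨fun t₁ t₂ h1 h2 => EfrosWright.phiConverges hα hα1 h1 h2, fun t₁ h1 h => ?_, ?_⟩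
  · exact (EfrosWright.integrableOn_phi_mul_besselFactor hα hα1 (by linarith)
      (fun h => by linarith [hβ1 h]) h1 lam fun h' => h ⟨h'.1, by linarith [h'.2]⟩).1
  · rcases ht.eq_or_lt with rfl | ht
    · exact ⟨by simp, by simpa using EfrosWright.hasDerivAt_zero_rpow_mul_wright hα lam⟩
    · have hcongr : ∀ x ∈ Set.uIoc 0 t, EfrosWright.outerIntegrand α β lam t x =
          (EfrosWright.logKernel (t - x) : ℂ) *
            EfrosWright.wrightSeries α (α + (β - 1)) lam x := fun x hx => by
        rw [Set.uIoc_of_le ht.le] at hx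
        exact EfrosWright.outerIntegrand_eq hα hα1 hαβ hβ1 lam t hx.1
      have hq : 0 < α + (β - 1) := by linarith
      constructor
      · exact (EfrosWright.intervalIntegrable_mul_wrightSeries hα.le hq ht.le lam
          (EfrosWright.logKernel_intervalIntegrable ht hq)).congr fun x hx => (hcongr x hx).symm
      · rw [intervalIntegral.integral_congr_ae (Filter.Eventually.of_forall hcongr)]
        simp only [EfrosWright.rpow_mul_wright lam ht]
        exact EfrosWright.hasDerivAt_wrightSeries_integral hα hβ hαβ ht lam
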